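/- **Setting.** Let $K,p,d,N$ be positive integers, let $U_1,\dots,U_K\in\mathbb R^{d\times p}$ satisfy $U_k^\top U_{k'}=\mathbf 1\{k=k'\}I$ for all $k,k'$, and let $\sigma\ge 0$, $\varepsilon>0$, $\eta>0$; put $\beta=\frac{p}{N\varepsilon^2}$. Let $s_1,\dots,s_N$ be i.i.d. uniform on $\{1,\dots,K\}$, let $\alpha_1,\dots,\alpha_N$ be i.i.d. $\mathcal N(0,\frac1p I_p)$ and $\delta_1,\dots,\delta_N$ i.i.d. $\mathcal N(0,\frac{\sigma^2}{d}I_d)$, all independent. Let $X_\natural\in\mathbb R^{d\times N}$ have columns $U_{s_i}\alpha_i$, let $\Delta\in\mathbb R^{d\times N}$ have columns $\delta_i$, and let $Z=X_\natural+\Delta$. Let $\Pi\in\mathbb R^{N\times N}$ be any permutation matrix (possibly depending on the outcome) that groups the tokens by subspace, in the order $1,\dots,K$, so that $$X_\natural=\begin{bmatrix}U_1A_1&\cdots&U_KA_K\end{bmatrix}\Pi ,$$ where the columns of $A_k\in\mathbb R^{p\times N_k}$, $N_k=\#\{i: s_i=k\}$, are the vectors $\alpha_i$ with $s_i=k$.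 Set $$P_k=\sum_{k'\ne k}U_{k'}\bigl(I-A_{k'}(\beta^{-1}I+A_{k'}^\top A_{k'})^{-1}A_{k'}^\top\bigr)U_{k'}^\top ,$$ and for a matrix $M=[M_1\ \cdots\ M_K]$ with $M_k\in\mathbb R^{d\times N_k}$ put $\mathcal P_{U_{[K]}}(M)=[P_1M_1\ \cdots\ P_KM_K]$. Let $$R^c(Z\mid U_{[K]})=\frac12\sum_{k=1}^K\log\det\bigl(I+\beta(U_k^\top Z)^\top U_k^\top Z\bigr),\qquad Z^+=Z-\eta\,\nabla_Z R^c(Z\mid U_{[K]}).$$ $\|\cdot\|$ denotes the operator norm ($\ell^2\to\ell^2$). **Theorem.** There are universal constants $c_1,c_2,c_3>0$ and $C_1,C_2,C_3,C_4,C_5>0$ such that the following holds. Suppose that $\varepsilon\le 1$, $d\ge N\ge p\ge K\ge 2$, $Kp=d$, $c_1\sqrt{N\log N}\le\frac12\frac NK$, $6c_2^2N\le d$ and $2c_3^2N\le d$, and moreover that $\sigma\le 1$ and $C_1\beta\sigma\le\frac12$. Then, with probability at least $$1-KC_2\bigl(e^{-C_3d}+e^{-C_4N/K}+N^{-2}\bigr),$$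 it holds (for every such $\Pi$) that $$\Bigl\|Z^+-\Bigl[\bigl(\Delta-\eta\,\mathcal P_{U_{[K]}}(\beta\Delta\Pi^\top)\Pi\bigr)+\frac{1+\beta^{-1}-\eta}{1+\beta^{-1}}X_\natural\Bigr]\Bigr\|\le C_5K\eta\Bigl(\sigma^2\beta^2+\sigma\bigl(1+\sqrt{N/d}\bigr)+\sqrt K\,\beta\sigma^2\bigl(1+\sqrt{N/d}\bigr)+\sqrt{N/d}\Bigr).$$ -/

import Mathlib

open MeasureTheory ProbabilityTheory
open scoped Matrix Matrix.Norms.L2Operator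

namespace TokenCompression

noncomputable section

/-- The relative scales of the parameters, for given constants `c₁ c₂ c₃`: quantization error
`0 < ε ≤ 1`, orthonormal bases `U k` of `K` pairwise orthogonal `p`-dimensional subspaces of `ℝ^d`,
and `N` tokens. -/
structure ParameterConfig (c₁ c₂ c₃ : ℝ) {d p K : ℕ} (N : ℕ) (ε : ℝ)
    (U : Fin K → Matrix (Fin d) (Fin p) ℝ) : Prop where
  eps_pos : 0 < ε
  eps_le_one : ε ≤ 1
  orthonormal : ∀ k, (U k)ᵀ * U k = 1
  orthogonal : ∀ k k', k ≠ k' → (U k)ᵀ * U k' = 0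
  two_le_K : 2 ≤ K
  K_le_p : K ≤ p
  p_le_N : p ≤ N
  N_le_d : N ≤ d
  K_mul_p : K * p = d
  class_size : c₁ * √(N * Real.log N) ≤ 1 / 2 * (N / K : ℝ)
  aspect_ratio : 6 * c₂ ^ 2 * N ≤ d
  aspect_ratio' : 2 * c₃ ^ 2 * N ≤ d

/-- Outcomes `(s, α, δ)`: for each of the `N` tokens `i`, the index `s i` of its subspace, its
coefficient vector `α i ∈ ℝ^p` and its noise vector `δ i ∈ ℝ^d`. -/
abbrev Outcome (d N p K : ℕ) : Type :=
  (Fin N → Fin K) × (Fin N → Fin p → ℝ) × (Fin N → Fin d → ℝ)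

/-- The law of the noisy Gaussian tokens: all coordinates of `(s, α, δ)` are independent, `s i` is
uniform on the `K` subspaces, `α i ∼ N(0, I / p)` and `δ i ∼ N(0, (σ² / d) I)`. -/
def tokenLaw (d N p K : ℕ) (σ : ℝ) : Measure (Outcome d N p K) :=
  (Measure.pi fun _ : Fin N => uniformOn (Set.univ : Set (Fin K))).prod
    ((Measure.pi fun _ : Fin N => Measure.pi fun _ : Fin p =>
        gaussianReal 0 (Real.toNNReal (1 / p))).prod
      (Measure.pi fun _ : Fin N => Measure.pi fun _ : Fin d =>
        gaussianReal 0 (Real.toNNReal (σ ^ 2 / d))))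

/-- The matrix with columns `v i`. -/
def columns {m N : ℕ} (v : Fin N → Fin m → ℝ) : Matrix (Fin m) (Fin N) ℝ :=
  Matrix.of fun a i => v i a

/-- The noise-free tokens `X_♮`, with columns `U_{s i} α i`. -/
def cleanTokens {d N p K : ℕ} (U : Fin K → Matrix (Fin d) (Fin p) ℝ) (s : Fin N → Fin K)
    (α : Fin N → Fin p → ℝ) : Matrix (Fin d) (Fin N) ℝ :=
  columns fun i => U (s i) *ᵥ α i

/-- `β = p / (N ε²)`. -/
def quantBeta (N p : ℕ) (ε : ℝ) : ℝ := p / (N * ε ^ 2)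

/-- The compression term
`R^c(Z | U) = 1/2 ∑ k, log det (I + β (U_kᵀ Z)ᵀ (U_kᵀ Z))`. -/
def codingRate {d N p K : ℕ} (U : Fin K → Matrix (Fin d) (Fin p) ℝ) (β : ℝ)
    (Z : Matrix (Fin d) (Fin N) ℝ) : ℝ :=
  1 / 2 * ∑ k, Real.log (1 + β • (((U k)ᵀ * Z)ᵀ * ((U k)ᵀ * Z))).det

/-- The gradient of a function of a `d × N` matrix: the matrix of its partial derivatives with
respect to the entries. It is used for `codingRate U β` with `β ≥ 0`, which is smooth because the
determinants are at least `1`. -/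
def matrixGradient {d N : ℕ} (f : Matrix (Fin d) (Fin N) ℝ → ℝ) (Z : Matrix (Fin d) (Fin N) ℝ) :
    Matrix (Fin d) (Fin N) ℝ :=
  Matrix.of fun a i => lineDeriv ℝ f Z (Matrix.single a i 1)

/-- One gradient step `Z⁺ = Z - η ∇R^c(Z | U)`. -/
def gradientStep {d N p K : ℕ} (U : Fin K → Matrix (Fin d) (Fin p) ℝ) (β η : ℝ)
    (Z : Matrix (Fin d) (Fin N) ℝ) : Matrix (Fin d) (Fin N) ℝ :=
  Z - η • matrixGradient (codingRate U β) Z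

/-- The `k`-th block of a matrix `A` whose columns are labelled by `t`: the submatrix of the columns
with label `k`. -/
def block {p N K : ℕ} (t : Fin N → Fin K) (A : Matrix (Fin p) (Fin N) ℝ) (k : Fin K) :
    Matrix (Fin p) {j : Fin N // t j = k} ℝ :=
  A.submatrix id Subtype.val

/-- `P_k = ∑_{k' ≠ k} U_{k'} (I - A_{k'} (β⁻¹ I + A_{k'}ᵀ A_{k'})⁻¹ A_{k'}ᵀ) U_{k'}ᵀ`, where `A_{k'}`
is the block of `A` with label `k'`. -/
def blockProjection {d N p K : ℕ} (U : Fin K → Matrix (Fin d) (Fin p) ℝ) (β : ℝ)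
    (t : Fin N → Fin K) (A : Matrix (Fin p) (Fin N) ℝ) (k : Fin K) : Matrix (Fin d) (Fin d) ℝ :=
  ∑ k' ∈ Finset.univ.erase k,
    U k' * (1 - block t A k' * (β⁻¹ • (1 : Matrix {j // t j = k'} {j // t j = k'} ℝ)
      + (block t A k')ᵀ * block t A k')⁻¹ * (block t A k')ᵀ) * (U k')ᵀ

/-- `P_{U_[K]} = [P_1 ⋯ P_K]` acting on block matrices, `[M_1 ⋯ M_K] ↦ [P_1 M_1 ⋯ P_K M_K]`: a column
with label `k` is multiplied by `P_k`. -/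
def projection {d N p K : ℕ} (U : Fin K → Matrix (Fin d) (Fin p) ℝ) (β : ℝ)
    (t : Fin N → Fin K) (A : Matrix (Fin p) (Fin N) ℝ) (M : Matrix (Fin d) (Fin N) ℝ) :
    Matrix (Fin d) (Fin N) ℝ :=
  columns fun j => blockProjection U β t A (t j) *ᵥ (M.col j)

/-- The nominal value `(Δ - η P_{U_[K]}(β Δ Πᵀ) Π) + ((1 + β⁻¹ - η) / (1 + β⁻¹)) X_♮` of the gradient
step. Here `Π` is the matrix of a permutation `π` that lists the tokens in the order
`π 0, π 1, …`; if `s ∘ π` is monotone, this lists first the tokens from the first subspace, then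
those from the second one, and so on, that is, `X_♮ = [U_1 A_1 ⋯ U_K A_K] Π`, where the columns of
`[A_1 ⋯ A_K]` are the coefficient vectors in that order. -/
def nominalStep {d N p K : ℕ} (U : Fin K → Matrix (Fin d) (Fin p) ℝ) (β η : ℝ)
    (π : Equiv.Perm (Fin N)) (s : Fin N → Fin K) (α : Fin N → Fin p → ℝ) (δ : Fin N → Fin d → ℝ) :
    Matrix (Fin d) (Fin N) ℝ :=
  (columns δ - η • (projection U β (s ∘ π) (columns α * (π.permMatrix ℝ)ᵀ)
      (β • (columns δ * (π.permMatrix ℝ)ᵀ)) * π.permMatrix ℝ))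
    + ((1 + β⁻¹ - η) / (1 + β⁻¹)) • cleanTokens U s α

end

end TokenCompression

open TokenCompression

/-! Write `R(X) = (I + β X Xᵀ)⁻¹`. The gradient of the coding rate is `∑ k, U_k β R(U_kᵀ Z) U_kᵀ Z`.
Orthogonality of the subspaces gives `U_kᵀ Z = A + D`, where `A` holds the coefficient vectors of
class `k`, padded by zero columns, and `D = U_kᵀ Δ`. A push-through identity turns each factor of
`P_k` into a resolvent `R(A)`. The error is therefore a sum over `k` of `U_k` times the difference
between `β R(A + D)(A + D)` and `β R(A) D (I - J) + β/(1+β) A`, with `J` the coordinate projection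
onto class `k`. The factor `K` in the bound counts these blocks (`gradientStep_sub_nominalStep`).

One block is deterministic perturbation theory (`norm_resolvent_perturbation_le`), given `‖Δ‖ ≤ 2σ`
and `‖AᵀA - J‖ ≤ t`. Split `A + D = B + F` into its columns inside and outside the class, so that `B
Fᵀ = 0`. Near-orthonormality of the columns of `B` gives `β R(B) B ≈ β/(1+β) B`, and resolvent
identities control the replacement of `R(A + D)` by `R(B)` on `B` and by `R(A)` on `F`.

The two hypotheses hold with high probability by `χ²` tail bounds on a net of a sphere, with `t` of
order `√(N/d)`. A class of size `n` costs a net of size `5 ^ n`. Averaging this over the uniform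
labels gives at most `exp (4N/K)`, so no separate control of the class sizes enters
(`tokenLaw_compl_goodEvent_le`). -/

namespace TokenCompression

/-! ### Resolvents and deterministic perturbation bounds. -/

section Resolvent

set_option linter.unusedSectionVars false

variable {m n : Type*} [Fintype m] [Fintype n] [DecidableEq m] [DecidableEq n]

theorem dotProduct_self_eq_norm_sq (x : n → ℝ) : x ⬝ᵥ x = ‖WithLp.toLp 2 x‖ ^ 2 := by
  rw [EuclideanSpace.norm_sq_eq]
  simp [dotProduct, sq]

theorem l2_opNorm_le_of_dotProduct_le (A : Matrix m n ℝ) {c : ℝ} (hc : 0 ≤ c)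
    (h : ∀ x, A *ᵥ x ⬝ᵥ A *ᵥ x ≤ c ^ 2 * (x ⬝ᵥ x)) : ‖A‖ ≤ c := by
  rw [Matrix.l2_opNorm_def]
  refine ContinuousLinearMap.opNorm_le_bound _ hc fun x => ?_
  refine abs_le_of_sq_le_sq' ?_ (by positivity) |>.2
  have := h x.ofLp
  rw [dotProduct_self_eq_norm_sq, dotProduct_self_eq_norm_sq] at this
  rw [mul_pow]
  exact this

theorem l2_opNorm_transpose (A : Matrix m n ℝ) : ‖Aᵀ‖ = ‖A‖ := by
  rw [← Matrix.conjTranspose_eq_transpose_of_trivial, Matrix.l2_opNorm_conjTranspose]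

theorem l2_opNorm_transpose_mul_self (A : Matrix m n ℝ) : ‖Aᵀ * A‖ = ‖A‖ * ‖A‖ := by
  rw [← Matrix.conjTranspose_eq_transpose_of_trivial, Matrix.l2_opNorm_conjTranspose_mul_self]

/-- The inverse of `I + β X Xᵀ`. -/
noncomputable def resolvent (β : ℝ) (X : Matrix m n ℝ) : Matrix m m ℝ := (1 + β • (X * Xᵀ))⁻¹

variable {β : ℝ}

theorem posDef_one_add_smul_mul_transpose (hβ : 0 ≤ β) (X : Matrix m n ℝ) :
    (1 + β • (X * Xᵀ)).PosDef := by
  refine Matrix.PosDef.one.add_posSemidef (Matrix.PosSemidef.smul ?_ hβ)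
  simpa using Matrix.posSemidef_self_mul_conjTranspose X

theorem isUnit_det_one_add_smul_mul_transpose (hβ : 0 ≤ β) (X : Matrix m n ℝ) :
    IsUnit (1 + β • (X * Xᵀ)).det :=
  (posDef_one_add_smul_mul_transpose hβ X).det_pos.ne'.isUnit

theorem mul_resolvent (hβ : 0 ≤ β) (X : Matrix m n ℝ) :
    (1 + β • (X * Xᵀ)) * resolvent β X = 1 :=
  Matrix.mul_nonsing_inv _ (isUnit_det_one_add_smul_mul_transpose hβ X)

theorem resolvent_mul (hβ : 0 ≤ β) (X : Matrix m n ℝ) :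
    resolvent β X * (1 + β • (X * Xᵀ)) = 1 :=
  Matrix.nonsing_inv_mul _ (isUnit_det_one_add_smul_mul_transpose hβ X)

theorem transpose_resolvent (X : Matrix m n ℝ) : (resolvent β X)ᵀ = resolvent β X := by
  simp [resolvent, Matrix.transpose_nonsing_inv]

/-- If `y = x + β X Xᵀ x`, expanding the square gives `|y|² ≥ |x|²`, because the cross term is `2β
|Xᵀ x|²`. -/
theorem norm_resolvent_le_one (hβ : 0 ≤ β) (X : Matrix m n ℝ) : ‖resolvent β X‖ ≤ 1 := by
  refine l2_opNorm_le_of_dotProduct_le _ zero_le_one fun y => ?_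
  set x := resolvent β X *ᵥ y with hx
  have hy : y = x + β • (X *ᵥ (Xᵀ *ᵥ x)) := by
    have : (1 + β • (X * Xᵀ)) *ᵥ x = y := by
      rw [hx, Matrix.mulVec_mulVec, mul_resolvent hβ, Matrix.one_mulVec]
    clear_value x
    rw [← this, Matrix.add_mulVec, Matrix.one_mulVec, Matrix.smul_mulVec, Matrix.mulVec_mulVec]
  have h1 : x ⬝ᵥ (X *ᵥ (Xᵀ *ᵥ x)) = (Xᵀ *ᵥ x) ⬝ᵥ (Xᵀ *ᵥ x) := by
    rw [Matrix.dotProduct_mulVec, Matrix.mulVec_transpose]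
  have h2 : 0 ≤ (Xᵀ *ᵥ x) ⬝ᵥ (Xᵀ *ᵥ x) := by
    rw [dotProduct_self_eq_norm_sq]; positivity
  have h3 : 0 ≤ (X *ᵥ (Xᵀ *ᵥ x)) ⬝ᵥ (X *ᵥ (Xᵀ *ᵥ x)) := by
    rw [dotProduct_self_eq_norm_sq]; positivity
  rw [hy]
  simp only [add_dotProduct, dotProduct_add, smul_dotProduct, dotProduct_smul, smul_eq_mul,
    dotProduct_comm _ x, h1]
  nlinarith [mul_nonneg hβ h2, mul_nonneg hβ (mul_nonneg hβ h3)]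

theorem resolvent_mul_self (hβ : 0 ≤ β) (X : Matrix m n ℝ) :
    resolvent β X * X = X * resolvent β Xᵀ := by
  have h : X * (1 + β • (Xᵀ * Xᵀᵀ)) = (1 + β • (X * Xᵀ)) * X := by
    simp [Matrix.mul_add, Matrix.add_mul, Matrix.mul_assoc]
  calc resolvent β X * X
      = resolvent β X * (X * ((1 + β • (Xᵀ * Xᵀᵀ)) * resolvent β Xᵀ)) := by
        rw [mul_resolvent hβ, Matrix.mul_one]
    _ = resolvent β X * (1 + β • (X * Xᵀ)) * (X * resolvent β Xᵀ) := by
        rw [← Matrix.mul_assoc X, h]; simp only [Matrix.mul_assoc]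
    _ = _ := by rw [resolvent_mul hβ, Matrix.one_mul]

theorem resolvent_sub_resolvent {n' : Type*} [Fintype n'] [DecidableEq n'] (hβ : 0 ≤ β)
    (X : Matrix m n ℝ) (Y : Matrix m n' ℝ) :
    resolvent β X - resolvent β Y =
      resolvent β X * (β • (Y * Yᵀ - X * Xᵀ)) * resolvent β Y := by
  have h : β • (Y * Yᵀ - X * Xᵀ) = (1 + β • (Y * Yᵀ)) - (1 + β • (X * Xᵀ)) := by
    rw [smul_sub]; abel
  rw [h, Matrix.mul_sub, Matrix.sub_mul, resolvent_mul hβ, Matrix.mul_assoc, mul_resolvent hβ]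
  simp

theorem norm_resolvent_sub_le {n' : Type*} [Fintype n'] [DecidableEq n'] (hβ : 0 ≤ β)
    (X : Matrix m n ℝ) (Y : Matrix m n' ℝ) :
    ‖resolvent β X - resolvent β Y‖ ≤ β * ‖Y * Yᵀ - X * Xᵀ‖ := by
  rw [resolvent_sub_resolvent hβ]
  calc _ ≤ ‖resolvent β X‖ * ‖β • (Y * Yᵀ - X * Xᵀ)‖ * ‖resolvent β Y‖ :=
        (Matrix.l2_opNorm_mul _ _).trans
          (mul_le_mul_of_nonneg_right (Matrix.l2_opNorm_mul _ _) (norm_nonneg _))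
    _ ≤ 1 * ‖β • (Y * Yᵀ - X * Xᵀ)‖ * 1 := by
        gcongr <;> exact norm_resolvent_le_one hβ _
    _ = _ := by rw [norm_smul, Real.norm_of_nonneg hβ]; ring

/-- A push-through form of the Woodbury identity. -/
theorem one_sub_mul_inv_mul_transpose (hβ : 0 < β) (X : Matrix m n ℝ) :
    1 - X * (β⁻¹ • (1 : Matrix n n ℝ) + Xᵀ * X)⁻¹ * Xᵀ = resolvent β X := by
  have h : (β⁻¹ • (1 : Matrix n n ℝ) + Xᵀ * X)⁻¹ = β • resolvent β Xᵀ := by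
    refine Matrix.inv_eq_right_inv ?_
    rw [Matrix.mul_smul, ← Matrix.smul_mul, smul_add, smul_smul, mul_inv_cancel₀ hβ.ne', one_smul]
    simpa using mul_resolvent hβ.le Xᵀ
  rw [h, Matrix.mul_smul, Matrix.smul_mul, ← resolvent_mul_self hβ.le, Matrix.mul_assoc,
    sub_eq_iff_eq_add, ← Matrix.mul_smul]
  nth_rw 1 [← Matrix.mul_one (resolvent β X)]
  rw [← Matrix.mul_add, resolvent_mul hβ.le]

theorem norm_transpose_mul_self_sub_le {X Y : Matrix m n ℝ} :
    ‖(X + Y)ᵀ * (X + Y) - Xᵀ * X‖ ≤ 2 * ‖X‖ * ‖Y‖ + ‖Y‖ ^ 2 := by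
  have h : (X + Y)ᵀ * (X + Y) - Xᵀ * X = Xᵀ * Y + Yᵀ * X + Yᵀ * Y := by
    simp only [Matrix.transpose_add, Matrix.add_mul, Matrix.mul_add]; abel
  rw [h]
  have h1 := Matrix.l2_opNorm_mul Xᵀ Y
  have h2 := Matrix.l2_opNorm_mul Yᵀ X
  have h3 := Matrix.l2_opNorm_mul Yᵀ Y
  rw [l2_opNorm_transpose] at h1 h2 h3
  have h4 := norm_add₃_le (a := Xᵀ * Y) (b := Yᵀ * X) (c := Yᵀ * Y)
  nlinarith

/-- If `BᵀB` is close to a projection `J` with `B J = B`, then `β B (I + β BᵀB)⁻¹` is close to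
`β / (1 + β) B`. -/
theorem norm_mul_resolvent_sub_le (hβ : 0 < β) {B : Matrix m n ℝ} {J : Matrix n n ℝ}
    (hJt : Jᵀ = J) (hJ2 : J * J = J) (hJ1 : ‖J‖ ≤ 1) (hBJ : B * J = B) {t : ℝ}
    (ht : ‖Bᵀ * B - J‖ ≤ t) (ht' : t ≤ 1 / 2 ∨ β ≤ 1) :
    β * ‖B * resolvent β Bᵀ‖ ≤ 2 * ‖B‖ ∧
      ‖β • (B * resolvent β Bᵀ) - (β / (1 + β)) • B‖ ≤ 2 * t * ‖B‖ := by
  -- Because `B J = B`, only the compressed factor `Y` matters. It solves `(1 + β) Y = J` up to the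
  -- error `β (J - BᵀB) Y`.
  set Y := J * resolvent β Bᵀ with hY
  have hBY : B * resolvent β Bᵀ = B * Y := by rw [hY, ← Matrix.mul_assoc, hBJ]
  have hJB : J * Bᵀ = Bᵀ := by
    have := congrArg Matrix.transpose hBJ
    rwa [Matrix.transpose_mul, hJt] at this
  have hkey : (1 + β) • Y = J + β • ((J - Bᵀ * B) * Y) := by
    have h := congrArg (J * ·) (mul_resolvent hβ.le Bᵀ)
    simp only [Matrix.transpose_transpose, Matrix.mul_one, Matrix.add_mul, Matrix.mul_add,
      Matrix.one_mul, Matrix.smul_mul, Matrix.mul_smul] at h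
    have h2 : J * (Bᵀ * B * resolvent β Bᵀ) = Bᵀ * B * Y := by
      rw [hY, ← Matrix.mul_assoc, ← Matrix.mul_assoc, ← Matrix.mul_assoc, hJB,
        Matrix.mul_assoc Bᵀ B J, hBJ]
    rw [h2] at h
    have h3 : J * Y = Y := by rw [hY, ← Matrix.mul_assoc, hJ2]
    rw [Matrix.sub_mul, h3, ← h, add_smul, one_smul, smul_sub]
    simp only [← hY]
    abel
  have ht0 : 0 ≤ t := (norm_nonneg _).trans ht
  have hY0 : 0 ≤ ‖Y‖ := norm_nonneg _
  have hJM : ‖(J - Bᵀ * B) * Y‖ ≤ t * ‖Y‖ :=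
    (Matrix.l2_opNorm_mul _ _).trans (by rw [norm_sub_rev]; gcongr)
  -- For `t ≤ 1/2` the error term is absorbed on the left; for `β ≤ 1` the trivial bound `‖Y‖ ≤ 1`
  -- suffices.
  have hYb : β * ‖Y‖ ≤ 2 := by
    rcases ht' with h | h
    · have : (1 + β) * ‖Y‖ ≤ 1 + β * (t * ‖Y‖) := by
        calc (1 + β) * ‖Y‖ = ‖(1 + β) • Y‖ := by
              rw [norm_smul, Real.norm_of_nonneg (by positivity)]
          _ ≤ ‖J‖ + ‖β • ((J - Bᵀ * B) * Y)‖ := by rw [hkey]; exact norm_add_le _ _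
          _ ≤ 1 + β * (t * ‖Y‖) := by
              rw [norm_smul, Real.norm_of_nonneg hβ.le]; gcongr
      have h5 : t * ‖Y‖ ≤ 1 / 2 * ‖Y‖ := by gcongr
      nlinarith
    · have : ‖Y‖ ≤ 1 := (Matrix.l2_opNorm_mul _ _).trans
        (mul_le_one₀ hJ1 (norm_nonneg _) (norm_resolvent_le_one hβ.le _))
      nlinarith
  have hB := Matrix.l2_opNorm_mul B Y
  refine ⟨by rw [hBY]; nlinarith [norm_nonneg B], ?_⟩
  have heq : β • (B * resolvent β Bᵀ) - (β / (1 + β)) • B =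
      (β / (1 + β)) • (B * (β • ((J - Bᵀ * B) * Y))) := by
    have h6 : β • ((J - Bᵀ * B) * Y) = (1 + β) • Y - J := by rw [hkey]; abel
    rw [h6, hBY, Matrix.mul_sub, hBJ, Matrix.mul_smul, smul_sub, smul_smul,
      div_mul_cancel₀ _ (by positivity)]
  rw [heq, norm_smul, Real.norm_of_nonneg (by positivity)]
  have h7 : β / (1 + β) ≤ 1 := by rw [div_le_one (by positivity)]; linarith
  have h8 : ‖β • ((J - Bᵀ * B) * Y)‖ ≤ 2 * t := by
    rw [norm_smul, Real.norm_of_nonneg hβ.le]; nlinarith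
  calc _ ≤ 1 * (‖B‖ * (2 * t)) := by
        gcongr
        exact (Matrix.l2_opNorm_mul _ _).trans (by gcongr)
    _ = _ := by ring

/-- The perturbation bound for one block of the gradient step. -/
theorem norm_resolvent_perturbation_le (hβ : 0 < β) {A D : Matrix m n ℝ} {J : Matrix n n ℝ}
    (hJt : Jᵀ = J) (hJ2 : J * J = J) (hJ1 : ‖J‖ ≤ 1) (hAJ : A * J = A) {t σ : ℝ}
    (ht : ‖Aᵀ * A - J‖ ≤ t) (ht' : t ≤ 1 / 4) (hσ : 0 ≤ σ) (hσ1 : σ ≤ 1)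
    (hβσ : 100 * β * σ ≤ 1 / 2) (hD : ‖D‖ ≤ 2 * σ) :
    ‖β • (resolvent β (A + D) * (A + D)) - (β • (resolvent β A * (D * (1 - J)))
        + (β / (1 + β)) • A)‖ ≤ 128 * (σ ^ 2 * β ^ 2 + σ + β * σ ^ 2) + 8 * t := by
  -- `B` collects the noisy columns inside the class and `F` the pure-noise columns outside it.
  set B := A + D * J with hB
  set F := D * (1 - J) with hF
  have hW : A + D = B + F := by rw [hB, hF, Matrix.mul_sub, Matrix.mul_one]; abel
  have hBJ : B * J = B := by rw [hB, Matrix.add_mul, hAJ, Matrix.mul_assoc, hJ2]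
  have hA : ‖A‖ ≤ 2 := by
    have h1 := l2_opNorm_transpose_mul_self A
    have h2 : ‖Aᵀ * A‖ ≤ ‖Aᵀ * A - J‖ + ‖J‖ := by
      simpa using norm_add_le (Aᵀ * A - J) J
    nlinarith [norm_nonneg A]
  have hDJ : ‖D * J‖ ≤ 2 * σ := (Matrix.l2_opNorm_mul _ _).trans (by nlinarith [norm_nonneg J])
  have hFn : ‖F‖ ≤ 4 * σ := by
    have : F = D - D * J := by rw [hF, Matrix.mul_sub, Matrix.mul_one]
    rw [this]
    exact (norm_sub_le _ _).trans (by linarith)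
  have hBn : ‖B‖ ≤ 4 := (norm_add_le _ _).trans (by linarith)
  have hM : ‖Bᵀ * B - J‖ ≤ t + 12 * σ := by
    have h1 : ‖Bᵀ * B - Aᵀ * A‖ ≤ 12 * σ := by
      refine norm_transpose_mul_self_sub_le.trans ?_
      nlinarith [norm_nonneg A, norm_nonneg (D * J)]
    have h2 := norm_add_le (Bᵀ * B - Aᵀ * A) (Aᵀ * A - J)
    rw [sub_add_sub_cancel] at h2
    linarith
  -- If `β > 1`, then `100 β σ ≤ 1/2` forces `σ ≤ 1/200`.
  have hcase : t + 12 * σ ≤ 1 / 2 ∨ β ≤ 1 := by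
    by_cases h : β ≤ 1
    · exact Or.inr h
    · left; nlinarith
  obtain ⟨h1, h2⟩ := norm_mul_resolvent_sub_le hβ hJt hJ2 hJ1 hBJ hM hcase
  -- The four errors: replacing `R(A + D)` by `R(B)` on `B`, comparing `β R(B) B` with `β/(1+β) B`,
  -- replacing `B` by `A`, and replacing `R(A + D)` by `R(A)` on `F`. In the first, one factor `β`
  -- stays with `B R(Bᵀ)`, whose product with `β` is bounded; this gives `β σ²` instead of `β² σ²`.
  have e1 : β • (resolvent β (A + D) * (A + D)) - (β • (resolvent β A * F) + (β / (1 + β)) • A) =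
      (resolvent β (A + D) * (β • (B * Bᵀ - (A + D) * (A + D)ᵀ))) * (β • (B * resolvent β Bᵀ))
      + (β • (B * resolvent β Bᵀ) - (β / (1 + β)) • B) + (β / (1 + β)) • (D * J)
      + β • ((resolvent β (A + D) - resolvent β A) * F) := by
    have h3 : (resolvent β (A + D) * (β • (B * Bᵀ - (A + D) * (A + D)ᵀ))) *
        (β • (B * resolvent β Bᵀ)) = β • (resolvent β (A + D) * B) - β • (B * resolvent β Bᵀ) := by
      rw [← resolvent_mul_self hβ.le, Matrix.mul_smul, ← Matrix.mul_assoc,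
        ← resolvent_sub_resolvent hβ.le, Matrix.sub_mul, smul_sub]
    have h4 : resolvent β (A + D) * (A + D) = resolvent β (A + D) * B + resolvent β (A + D) * F := by
      rw [← Matrix.mul_add, hW]
    rw [h3, h4, Matrix.sub_mul, hB]
    simp only [smul_add, smul_sub]
    abel
  -- The disjoint column supports kill the cross terms, so the difference is quadratic in the noise.
  have hFD : B * Bᵀ - (A + D) * (A + D)ᵀ = -(F * Fᵀ) := by
    have hBF : B * Fᵀ = 0 := by
      rw [hF, Matrix.transpose_mul, Matrix.transpose_sub, hJt, Matrix.transpose_one, ← hBJ,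
        Matrix.mul_assoc, ← Matrix.mul_assoc J, Matrix.mul_sub, hJ2]
      simp
    have hFB : F * Bᵀ = 0 := by
      have := congrArg Matrix.transpose hBF
      simpa using this
    have hBF2 : (B + F) * (B + F)ᵀ = B * Bᵀ + F * Fᵀ := by
      clear_value B F
      rw [Matrix.transpose_add, Matrix.mul_add, Matrix.add_mul, Matrix.add_mul, hBF, hFB]
      abel
    rw [hW, hBF2]
    abel
  have hFF : ‖F * Fᵀ‖ ≤ 16 * σ ^ 2 := by
    have := Matrix.l2_opNorm_mul F Fᵀ
    rw [l2_opNorm_transpose] at this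
    nlinarith [norm_nonneg F]
  have b1 : ‖(resolvent β (A + D) * (β • (B * Bᵀ - (A + D) * (A + D)ᵀ))) *
      (β • (B * resolvent β Bᵀ))‖ ≤ 128 * (β * σ ^ 2) := by
    have h5 : ‖β • (B * resolvent β Bᵀ)‖ ≤ 8 := by
      rw [norm_smul, Real.norm_of_nonneg hβ.le]; linarith
    have h6 : ‖β • (B * Bᵀ - (A + D) * (A + D)ᵀ)‖ ≤ β * (16 * σ ^ 2) := by
      rw [norm_smul, Real.norm_of_nonneg hβ.le, hFD, norm_neg]; gcongr
    calc _ ≤ (1 * (β * (16 * σ ^ 2))) * 8 := by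
          refine (Matrix.l2_opNorm_mul _ _).trans ?_
          gcongr
          refine (Matrix.l2_opNorm_mul _ _).trans ?_
          gcongr
          exact norm_resolvent_le_one hβ.le _
      _ = _ := by ring
  have b2 : ‖(β / (1 + β)) • (D * J)‖ ≤ 2 * σ := by
    have h7 : β / (1 + β) ≤ 1 := by rw [div_le_one (by positivity)]; linarith
    rw [norm_smul, Real.norm_of_nonneg (by positivity)]
    nlinarith [norm_nonneg (D * J)]
  have b3 : ‖β • ((resolvent β (A + D) - resolvent β A) * F)‖ ≤ 48 * (σ ^ 2 * β ^ 2) := by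
    have h8 : ‖A * Aᵀ - (A + D) * (A + D)ᵀ‖ ≤ 12 * σ := by
      have := norm_transpose_mul_self_sub_le (X := Aᵀ) (Y := Dᵀ)
      rw [← Matrix.transpose_add, Matrix.transpose_transpose, Matrix.transpose_transpose,
        l2_opNorm_transpose, l2_opNorm_transpose, norm_sub_rev] at this
      nlinarith [norm_nonneg A, norm_nonneg D]
    have h9 := norm_resolvent_sub_le hβ.le (A + D) A
    rw [norm_smul, Real.norm_of_nonneg hβ.le]
    calc _ ≤ β * ((β * (12 * σ)) * (4 * σ)) := by
          gcongr
          refine (Matrix.l2_opNorm_mul _ _).trans ?_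
          gcongr
          exact h9.trans (by gcongr)
      _ = _ := by ring
  rw [e1]
  have hn := norm_add₄_le (a := (resolvent β (A + D) * (β • (B * Bᵀ - (A + D) * (A + D)ᵀ))) *
      (β • (B * resolvent β Bᵀ))) (b := β • (B * resolvent β Bᵀ) - (β / (1 + β)) • B)
      (c := (β / (1 + β)) • (D * J)) (d := β • ((resolvent β (A + D) - resolvent β A) * F))
  have ht0 : 0 ≤ t := (norm_nonneg _).trans ht
  have h10 : 2 * (t + 12 * σ) * ‖B‖ ≤ 8 * (t + 12 * σ) := by
    nlinarith [norm_nonneg B]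
  have h11 : 0 ≤ σ ^ 2 * β ^ 2 := by positivity
  linarith

end Resolvent

/-! ### The gradient of the coding rate. -/

/-- Jacobi's formula. -/
theorem hasDerivAt_det {n : Type*} [Fintype n] [DecidableEq n] {G : ℝ → Matrix n n ℝ}
    {G' : Matrix n n ℝ} {t : ℝ} (h : ∀ i j, HasDerivAt (fun s => G s i j) (G' i j) t) :
    HasDerivAt (fun s => (G s).det) ((G t).adjugate * G').trace t := by
  have h1 : HasDerivAt (fun s => (G s).det)
      (∑ τ : Equiv.Perm n, ((Equiv.Perm.sign τ : ℤ) : ℝ) *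
        ∑ j, (∏ i ∈ Finset.univ.erase j, G t (τ i) i) • G' (τ j) j) t := by
    simp only [Matrix.det_apply, Units.smul_def, zsmul_eq_mul]
    exact HasDerivAt.fun_sum fun τ _ =>
      (HasDerivAt.fun_finsetProd fun i _ => h (τ i) i).const_mul _
  convert h1 using 1
  simp only [Finset.mul_sum]
  rw [Finset.sum_comm, Matrix.trace]
  refine Finset.sum_congr rfl fun j _ => ?_
  -- By Cramer's rule each diagonal entry is the determinant with column `j` differentiated, which
  -- matches the Leibniz expansion.
  have h2 : ((G t).adjugate * G').diag j = ((G t).updateCol j (fun i => G' i j)).det := by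
    rw [← Matrix.cramer_apply, Matrix.cramer_eq_adjugate_mulVec]
    rfl
  rw [h2, Matrix.det_apply]
  refine Finset.sum_congr rfl fun τ _ => ?_
  rw [Units.smul_def, zsmul_eq_mul, ← Finset.prod_erase_mul _ _ (Finset.mem_univ j), smul_eq_mul]
  congr 2
  · exact Finset.prod_congr rfl fun i hi => Matrix.updateCol_ne (Finset.ne_of_mem_erase hi)
  · simp

/-- The Gram matrix is quadratic in `t`, so only its linear coefficient survives at `0`. The two
halves of that coefficient are transposes of each other and have equal trace against the symmetric
resolvent, whence the factor `2`. -/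
theorem hasDerivAt_log_det_one_add {m n : Type*} [Fintype m] [Fintype n] [DecidableEq m]
    [DecidableEq n] {β : ℝ} (hβ : 0 ≤ β) (W H : Matrix m n ℝ) :
    HasDerivAt (fun t : ℝ => Real.log (1 + β • ((W + t • H)ᵀ * (W + t • H))).det)
      (2 * β * (resolvent β Wᵀ * Wᵀ * H).trace) 0 := by
  set G : ℝ → Matrix n n ℝ := fun t => 1 + β • ((W + t • H)ᵀ * (W + t • H)) with hG
  have hexp : ∀ t, G t = 1 + β • (Wᵀ * W) + t • (β • (Wᵀ * H + Hᵀ * W)) +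
      t ^ 2 • (β • (Hᵀ * H)) := by
    intro t
    simp only [hG, Matrix.transpose_add, Matrix.transpose_smul, Matrix.add_mul, Matrix.mul_add,
      Matrix.smul_mul, Matrix.mul_smul, smul_add, smul_smul]
    rw [mul_comm t β, show t ^ 2 * β = β * (t * t) by ring]
    abel
  have hd : ∀ i j, HasDerivAt (fun s => G s i j) ((β • (Wᵀ * H + Hᵀ * W)) i j) 0 := by
    intro i j
    simp only [hexp]
    have := ((((hasDerivAt_id (0 : ℝ)).mul_const ((β • (Wᵀ * H + Hᵀ * W)) i j)).const_add
      ((1 + β • (Wᵀ * W) : Matrix n n ℝ) i j))).add ((hasDerivAt_pow 2 (0 : ℝ)).mul_const ((β • (Hᵀ * H)) i j))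
    exact this.congr_deriv (by simp)
  have hG0 : G 0 = 1 + β • (Wᵀ * Wᵀᵀ) := by simp [hG]
  have hu := isUnit_det_one_add_smul_mul_transpose hβ Wᵀ
  have hdet := (hasDerivAt_det hd).log (by rw [hG0]; exact hu.ne_zero)
  convert hdet using 1
  have hinv : resolvent β Wᵀ = (G 0).det⁻¹ • (G 0).adjugate := by
    rw [resolvent, Matrix.inv_def, hG0, Ring.inverse_eq_inv']
  have htr : (resolvent β Wᵀ * (Hᵀ * W)).trace = (resolvent β Wᵀ * (Wᵀ * H)).trace := by
    rw [← Matrix.trace_transpose, Matrix.transpose_mul, transpose_resolvent, Matrix.trace_mul_comm,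
      Matrix.transpose_mul, Matrix.transpose_transpose]
  have h3 : ((G 0).adjugate * (β • (Wᵀ * H + Hᵀ * W))).trace / (G 0).det =
      (resolvent β Wᵀ * (β • (Wᵀ * H + Hᵀ * W))).trace := by
    rw [hinv, Matrix.smul_mul, Matrix.trace_smul, smul_eq_mul, div_eq_inv_mul]
  rw [h3, Matrix.mul_smul, Matrix.trace_smul, Matrix.mul_add, Matrix.trace_add, htr,
    Matrix.mul_assoc, smul_eq_mul]
  ring

theorem matrixGradient_codingRate {d N p K : ℕ} (U : Fin K → Matrix (Fin d) (Fin p) ℝ) {β : ℝ}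
    (hβ : 0 ≤ β) (Z : Matrix (Fin d) (Fin N) ℝ) :
    matrixGradient (codingRate U β) Z =
      ∑ k, U k * (β • (resolvent β ((U k)ᵀ * Z) * ((U k)ᵀ * Z))) := by
  ext a i
  have h : HasDerivAt (fun t : ℝ => codingRate U β (Z + t • Matrix.single a i (1 : ℝ)))
      (1 / 2 * ∑ k, 2 * β * (resolvent β ((U k)ᵀ * Z)ᵀ * ((U k)ᵀ * Z)ᵀ *
        ((U k)ᵀ * Matrix.single a i (1 : ℝ))).trace) 0 := by
    refine HasDerivAt.const_mul _ (HasDerivAt.fun_sum fun k _ => ?_)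
    have h1 := hasDerivAt_log_det_one_add hβ ((U k)ᵀ * Z) ((U k)ᵀ * Matrix.single a i (1 : ℝ))
    simpa only [← Matrix.mul_smul, ← Matrix.mul_add] using h1
  have h2 : matrixGradient (codingRate U β) Z a i = _ := h.deriv
  rw [h2, Finset.mul_sum, Matrix.sum_apply]
  refine Finset.sum_congr rfl fun k _ => ?_
  have h4 : resolvent β ((U k)ᵀ * Z)ᵀ * ((U k)ᵀ * Z)ᵀ * (U k)ᵀ =
      (U k * (resolvent β ((U k)ᵀ * Z) * ((U k)ᵀ * Z)))ᵀ := by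
    rw [Matrix.transpose_mul (U k), Matrix.transpose_mul (resolvent _ _), transpose_resolvent,
      resolvent_mul_self hβ, Matrix.transpose_transpose]
  rw [← Matrix.mul_assoc, h4, Matrix.trace_mul_single, Matrix.transpose_apply, Matrix.mul_smul,
    Matrix.smul_apply]
  simp only [MulOpposite.op_one, one_smul, smul_eq_mul]
  ring

/-! ### Nets and operator norms of symmetric matrices. -/

section Net

set_option linter.unusedSectionVars false

/-- A 1-separated subset of maximal cardinality is a 1-net. Radius `2` with separation `1` is the
normalization of the packing bound `Besicovitch.card_le_of_separated`. -/
theorem exists_sphere_net (E : Type*) [NormedAddCommGroup E] [NormedSpace ℝ E]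
    [FiniteDimensional ℝ E] :
    ∃ T : Finset E, T.card ≤ 5 ^ Module.finrank ℝ E ∧ (∀ c ∈ T, ‖c‖ = 2) ∧
      ∀ x : E, ‖x‖ = 2 → ∃ c ∈ T, ‖x - c‖ ≤ 1 := by
  classical
  let P : Finset E → Prop := fun T => (∀ c ∈ T, ‖c‖ = 2) ∧ ∀ c ∈ T, ∀ e ∈ T, c ≠ e → 1 ≤ ‖c - e‖
  have hcard : ∀ T, P T → T.card ≤ 5 ^ Module.finrank ℝ E := fun T hT =>
    Besicovitch.card_le_of_separated T (fun c hc => (hT.1 c hc).le) hT.2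
  let Q : ℕ → Prop := fun n => ∃ T, P T ∧ T.card = n
  obtain ⟨T, hT, hTn⟩ : Q (Nat.findGreatest Q (5 ^ Module.finrank ℝ E)) :=
    Nat.findGreatest_spec (Nat.zero_le _) ⟨∅, by simp [P], rfl⟩
  refine ⟨T, hcard T hT, hT.1, fun x hx => ?_⟩
  by_contra! hne
  have hxT : x ∉ T := fun h => by
    have := hne x h
    simp at this
    linarith
  have hP : P (insert x T) := by
    refine ⟨fun c hc => ?_, fun c hc e he hce => ?_⟩
    · rcases Finset.mem_insert.1 hc with rfl | hc
      exacts [hx, hT.1 c hc]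
    · rcases Finset.mem_insert.1 hc with hcx | hcT <;> rcases Finset.mem_insert.1 he with hex | heT
      · exact absurd (hcx.trans hex.symm) hce
      · rw [hcx]; exact (hne e heT).le
      · rw [norm_sub_rev, hex]; exact (hne c hcT).le
      · exact hT.2 c hcT e heT hce
  have h1 : (insert x T).card ≤ Nat.findGreatest Q (5 ^ Module.finrank ℝ E) :=
    Nat.le_findGreatest (hcard _ hP) ⟨_, hP, rfl⟩
  rw [Finset.card_insert_of_notMem hxT, hTn] at h1
  omega

variable {ι : Type*} [Fintype ι] [DecidableEq ι]

theorem exists_coordinate_sphere_net (S : Finset ι) :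
    ∃ T : Finset (ι → ℝ), T.card ≤ 5 ^ S.card ∧ (∀ c ∈ T, c ⬝ᵥ c = 4 ∧ ∀ i ∉ S, c i = 0) ∧
      ∀ x : ι → ℝ, x ⬝ᵥ x = 4 → (∀ i ∉ S, x i = 0) → ∃ c ∈ T, (x - c) ⬝ᵥ (x - c) ≤ 1 := by
  classical
  obtain ⟨T, hTc, hT, hnet⟩ := exists_sphere_net (EuclideanSpace ℝ S)
  let e : EuclideanSpace ℝ S → ι → ℝ := fun c i => if h : i ∈ S then c ⟨i, h⟩ else 0
  have he0 : ∀ c, ∀ i ∉ S, e c i = 0 := fun c i hi => by simp [e, hi]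
  have hdot : ∀ x : ι → ℝ, (∀ i ∉ S, x i = 0) →
      x ⬝ᵥ x = ‖(WithLp.toLp 2 fun i : S => x i : EuclideanSpace ℝ S)‖ ^ 2 := by
    intro x hx
    rw [EuclideanSpace.norm_sq_eq, dotProduct]
    simp only [Real.norm_eq_abs, sq_abs]
    rw [Finset.sum_coe_sort S (fun i => x i ^ 2)]
    rw [← Finset.sum_subset (Finset.subset_univ S) fun i _ hi => by rw [hx i hi, mul_zero]]
    exact Finset.sum_congr rfl fun i _ => (sq _).symm
  have hrestr : ∀ c, (WithLp.toLp 2 fun i : S => e c i : EuclideanSpace ℝ S) = c := by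
    intro c
    ext i
    simp [e]
  refine ⟨T.image e, Finset.card_image_le.trans (by simpa using hTc), ?_, fun x hx hxS => ?_⟩
  · intro c' hc'
    obtain ⟨c, hc, rfl⟩ := Finset.mem_image.1 hc'
    refine ⟨?_, he0 c⟩
    rw [hdot _ (he0 c), hrestr, hT c hc]
    norm_num
  · obtain ⟨c, hc, hxc⟩ := hnet (WithLp.toLp 2 fun i : S => x i) (by
      rw [hdot x hxS] at hx
      nlinarith [norm_nonneg (WithLp.toLp 2 fun i : S => x i : EuclideanSpace ℝ S)])
    refine ⟨e c, Finset.mem_image_of_mem e hc, ?_⟩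
    rw [hdot _ fun i hi => by simp [hxS i hi, he0 c i hi]]
    have h2 : (WithLp.toLp 2 fun i : S => (x - e c) i : EuclideanSpace ℝ S) =
        (WithLp.toLp 2 fun i : S => x i) - c := by
      ext i
      simp [e]
    rw [h2]
    exact pow_le_one₀ (norm_nonneg _) hxc

/-- Polarization: compare the form at `b x + M x` and `b x - M x`. Taking `b = a + r` with `r > 0`
allows the final division by `b`. -/
theorem l2_opNorm_le_of_abs_quadraticForm_le {M : Matrix ι ι ℝ} (hM : Mᵀ = M) {a : ℝ}
    (ha : 0 ≤ a) (h : ∀ x, |x ⬝ᵥ M *ᵥ x| ≤ a * (x ⬝ᵥ x)) : ‖M‖ ≤ a := by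
  refine le_of_forall_pos_le_add fun r hr => ?_
  have hpos : 0 < a + r := by linarith
  have h' : ∀ x, |x ⬝ᵥ M *ᵥ x| ≤ (a + r) * (x ⬝ᵥ x) := fun x => (h x).trans (by
    have : 0 ≤ x ⬝ᵥ x := by rw [dotProduct_self_eq_norm_sq]; positivity
    nlinarith)
  refine l2_opNorm_le_of_dotProduct_le _ hpos.le fun x => ?_
  set b := a + r
  set y := M *ᵥ x with hy
  have hsymm : ∀ u v, u ⬝ᵥ M *ᵥ v = v ⬝ᵥ M *ᵥ u := by
    intro u v
    rw [Matrix.dotProduct_mulVec, ← Matrix.mulVec_transpose, hM, dotProduct_comm]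
  have h1 := (abs_le.1 (h' (b • x + y))).2
  have h2 := (abs_le.1 (h' (b • x - y))).1
  have h3 : y ⬝ᵥ M *ᵥ x = y ⬝ᵥ y := rfl
  have h4 : x ⬝ᵥ M *ᵥ y = y ⬝ᵥ y := by rw [hsymm]
  simp only [Matrix.mulVec_add, Matrix.mulVec_sub, Matrix.mulVec_smul, add_dotProduct,
    sub_dotProduct, dotProduct_add, dotProduct_sub, smul_dotProduct, dotProduct_smul, smul_eq_mul,
    h3, h4] at h1 h2
  have h5 : 0 < b := hpos
  have h6 : b * (y ⬝ᵥ y) ≤ b * (b ^ 2 * (x ⬝ᵥ x)) := by nlinarith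
  exact le_of_mul_le_mul_left h6 h5

theorem abs_dotProduct_mulVec_le (M : Matrix ι ι ℝ) (u v : ι → ℝ) :
    |u ⬝ᵥ M *ᵥ v| ≤ ‖M‖ * (‖WithLp.toLp 2 u‖ * ‖WithLp.toLp 2 v‖) := by
  have h1 := abs_real_inner_le_norm (WithLp.toLp 2 (M *ᵥ v) : EuclideanSpace ℝ ι) (WithLp.toLp 2 u)
  have h2 := Matrix.l2_opNorm_mulVec M (WithLp.toLp 2 v)
  have h3 : inner ℝ (WithLp.toLp 2 (M *ᵥ v) : EuclideanSpace ℝ ι) (WithLp.toLp 2 u) =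
      u ⬝ᵥ M *ᵥ v := by
    simp [PiLp.inner_apply, dotProduct]
  rw [h3] at h1
  calc _ ≤ _ := h1
    _ ≤ (‖M‖ * ‖WithLp.toLp 2 v‖) * ‖WithLp.toLp 2 u‖ := by gcongr; exact h2
    _ = _ := by ring

/-- The orthogonal projection onto the coordinates in `S`. -/
def coordProj (S : Finset ι) : Matrix ι ι ℝ := Matrix.diagonal fun i => if i ∈ S then 1 else 0

theorem transpose_coordProj (S : Finset ι) : (coordProj S)ᵀ = coordProj S :=
  Matrix.diagonal_transpose _

theorem coordProj_mul_self (S : Finset ι) : coordProj S * coordProj S = coordProj S := by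
  simp [coordProj, Matrix.diagonal_mul_diagonal]

theorem norm_coordProj_le_one (S : Finset ι) : ‖coordProj S‖ ≤ 1 := by
  rw [coordProj, Matrix.l2_opNorm_diagonal, pi_norm_le_iff_of_nonneg zero_le_one]
  intro i
  split_ifs <;> simp

/-- The norm of a symmetric matrix supported on `S × S` is controlled by its quadratic form on a
net. -/
theorem exists_net_l2_opNorm_le (S : Finset ι) :
    ∃ T : Finset (ι → ℝ), T.card ≤ 5 ^ S.card ∧ (∀ c ∈ T, c ⬝ᵥ c = 4 ∧ ∀ i ∉ S, c i = 0) ∧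
      ∀ M : Matrix ι ι ℝ, Mᵀ = M → coordProj S * M * coordProj S = M → ∀ s : ℝ, 0 ≤ s →
        (∀ c ∈ T, |c ⬝ᵥ M *ᵥ c| ≤ 4 * s) → ‖M‖ ≤ 40 * s := by
  obtain ⟨T, hTc, hT, hnet⟩ := exists_coordinate_sphere_net S
  refine ⟨T, hTc, hT, fun M hMt hMS s hs h => ?_⟩
  have hm : 0 ≤ ‖M‖ := norm_nonneg M
  have hsphere : ∀ x : ι → ℝ, x ⬝ᵥ x = 4 → (∀ i ∉ S, x i = 0) →
      |x ⬝ᵥ M *ᵥ x| ≤ 4 * (s + 39 / 40 * ‖M‖) := by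
    intro x hx hxS
    obtain ⟨c, hc, hxc⟩ := hnet x hx hxS
    have h1 : x ⬝ᵥ M *ᵥ x = c ⬝ᵥ M *ᵥ c + (x - c) ⬝ᵥ M *ᵥ (x + c) := by
      have : c ⬝ᵥ M *ᵥ x = x ⬝ᵥ M *ᵥ c := by
        rw [Matrix.dotProduct_mulVec, ← Matrix.mulVec_transpose, hMt, dotProduct_comm]
      rw [Matrix.mulVec_add, sub_dotProduct, dotProduct_add, dotProduct_add, this]
      ring
    have h2 : (x - c) ⬝ᵥ (x - c) + (x + c) ⬝ᵥ (x + c) = 16 := by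
      have := (hT c hc).1
      simp only [sub_dotProduct, dotProduct_sub, add_dotProduct, dotProduct_add]
      linarith
    rw [dotProduct_self_eq_norm_sq, dotProduct_self_eq_norm_sq] at h2
    rw [dotProduct_self_eq_norm_sq] at hxc
    have h3 := abs_dotProduct_mulVec_le M (x - c) (x + c)
    set u := ‖WithLp.toLp 2 (x - c)‖
    set w := ‖WithLp.toLp 2 (x + c)‖
    -- The crude bound `u w ≤ 1 * 4` would leave no contraction. The parallelogram law gives `u² w²
    -- = u² (16 - u²) ≤ 15 < 3.9²`, so the term in `‖M‖` can be absorbed, at the price of the factor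
    -- `40`.
    have h4 : u * w ≤ 39 / 10 := by
      refine abs_le_of_sq_le_sq' ?_ (by norm_num) |>.2
      have : w ^ 2 = 16 - u ^ 2 := by linarith
      rw [mul_pow, this]
      nlinarith
    rw [h1]
    calc _ ≤ |c ⬝ᵥ M *ᵥ c| + |(x - c) ⬝ᵥ M *ᵥ (x + c)| := abs_add_le _ _
      _ ≤ 4 * s + ‖M‖ * (39 / 10) := add_le_add (h c hc) (h3.trans (by gcongr))
      _ = _ := by ring
  have hsupp : ∀ x : ι → ℝ, (∀ i ∉ S, x i = 0) →
      |x ⬝ᵥ M *ᵥ x| ≤ (s + 39 / 40 * ‖M‖) * (x ⬝ᵥ x) := by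
    intro x hxS
    rw [dotProduct_self_eq_norm_sq]
    set r := ‖(WithLp.toLp 2 x : EuclideanSpace ℝ ι)‖ with hr
    rcases (norm_nonneg (WithLp.toLp 2 x : EuclideanSpace ℝ ι)).eq_or_lt with h0 | h0
    · have hx0 : x = 0 := by
        have := norm_eq_zero.1 h0.symm
        simpa using congrArg WithLp.ofLp this
      simp [hx0]
      positivity
    · have h1 := hsphere ((2 / r) • x) (by
        rw [smul_dotProduct, dotProduct_smul, dotProduct_self_eq_norm_sq, ← hr, smul_eq_mul,
          smul_eq_mul]
        have : r ≠ 0 := h0.ne'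
        field_simp
        norm_num) (fun i hi => by simp [hxS i hi])
      rw [Matrix.mulVec_smul, smul_dotProduct, dotProduct_smul, smul_eq_mul, smul_eq_mul, abs_mul,
        abs_mul, abs_of_pos (show 0 < 2 / r by positivity)] at h1
      have h2 : 2 / r * (2 / r * |x ⬝ᵥ M *ᵥ x|) = 4 * (|x ⬝ᵥ M *ᵥ x| / r ^ 2) := by
        field_simp; ring
      rw [h2] at h1
      have h3 : |x ⬝ᵥ M *ᵥ x| / r ^ 2 ≤ s + 39 / 40 * ‖M‖ := by linarith
      rwa [div_le_iff₀ (by positivity)] at h3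
  have hall : ‖M‖ ≤ s + 39 / 40 * ‖M‖ := by
    refine l2_opNorm_le_of_abs_quadraticForm_le hMt (by positivity) fun x => ?_
    have h1 : x ⬝ᵥ M *ᵥ x = (coordProj S *ᵥ x) ⬝ᵥ M *ᵥ (coordProj S *ᵥ x) := by
      nth_rw 1 [← hMS]
      rw [← Matrix.mulVec_mulVec, ← Matrix.mulVec_mulVec, Matrix.dotProduct_mulVec,
        ← Matrix.mulVec_transpose, transpose_coordProj]
    rw [h1]
    refine (hsupp _ fun i hi => by simp [coordProj, Matrix.mulVec_diagonal, hi]).trans ?_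
    have h2 : (coordProj S *ᵥ x) ⬝ᵥ (coordProj S *ᵥ x) ≤ x ⬝ᵥ x := by
      refine Finset.sum_le_sum fun i _ => ?_
      simp only [coordProj, Matrix.mulVec_diagonal]
      split_ifs
      · simp
      · simpa using mul_self_nonneg (x i)
    gcongr
  linarith

end Net

/-! ### Gaussian vectors and `χ²` concentration. -/

section Gaussian

open scoped NNReal

theorem inv_one_sub_le_exp {y : ℝ} (h2 : y ≤ 1 / 2) :
    (1 - y)⁻¹ ≤ Real.exp (y + y ^ 2) := by
  rw [inv_le_iff_one_le_mul₀ (by linarith)]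
  rcases le_total 0 y with h | h
  · have h3 := Real.quadratic_le_exp_of_nonneg (show 0 ≤ y + y ^ 2 by positivity)
    have h4 : 0 ≤ (1 - y) := by linarith
    have h5 : 1 ≤ (1 + (y + y ^ 2) + (y + y ^ 2) ^ 2 / 2) * (1 - y) := by
      have h6 : 2 * y ≤ (1 + y) ^ 2 * (1 - y) := by nlinarith
      nlinarith [mul_nonneg (sq_nonneg y) (sub_nonneg.2 h6)]
    nlinarith
  · have h3 := Real.add_one_le_exp (y + y ^ 2)
    nlinarith [mul_nonneg (sq_nonneg y) (neg_nonneg.2 h)]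

theorem integral_exp_mul_sq_gaussianReal {w : ℝ≥0} (hw : w ≠ 0) {l : ℝ} (hl : 2 * l * w < 1) :
    ∫ x, Real.exp (l * x ^ 2) ∂gaussianReal 0 w = √((1 - 2 * l * w)⁻¹) := by
  have hw' : (0 : ℝ) < w := by positivity
  rw [integral_gaussianReal_eq_integral_smul hw]
  have h : ∀ x : ℝ, gaussianPDFReal 0 w x • Real.exp (l * x ^ 2) =
      (√(2 * Real.pi * w))⁻¹ * Real.exp (-((1 - 2 * l * w) / (2 * w)) * x ^ 2) := by
    intro x
    rw [gaussianPDFReal, smul_eq_mul, mul_assoc, ← Real.exp_add]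
    congr 2
    field_simp
    ring
  simp_rw [h]
  rw [integral_const_mul, integral_gaussian, ← Real.sqrt_inv, ← Real.sqrt_mul (by positivity)]
  congr 1
  have : 1 - 2 * l * w ≠ 0 := by linarith
  field_simp

variable {p : ℕ}

theorem integrable_exp_mul_sum_sq {w : ℝ≥0} (hw : w ≠ 0) {l : ℝ} (hl : 2 * l * w < 1) :
    Integrable (fun g : Fin p → ℝ => Real.exp (l * ∑ a, g a ^ 2))
      (Measure.pi fun _ => gaussianReal 0 w) := by
  simp_rw [Finset.mul_sum, Real.exp_sum]
  refine Integrable.fintype_prod (f := fun _ x => Real.exp (l * x ^ 2)) fun _ => ?_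
  -- A nonintegrable function has integral `0` by convention, so a nonzero integral proves
  -- integrability.
  refine not_imp_comm.1 integral_undef ?_
  rw [integral_exp_mul_sq_gaussianReal hw hl]
  have : 0 < 1 - 2 * l * w := by linarith
  positivity

theorem mgf_sum_sq_le {w : ℝ≥0} (hw : w ≠ 0) {y : ℝ} (h2 : y ≤ 1 / 2) :
    mgf (fun g : Fin p → ℝ => ∑ a, g a ^ 2) (Measure.pi fun _ => gaussianReal 0 w) (y / (2 * w)) ≤
      Real.exp (p * ((y + y ^ 2) / 2)) := by
  have hw' : (0 : ℝ) < w := by positivity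
  have hy : 2 * (y / (2 * w)) * w = y := by field_simp
  have h : mgf (fun g : Fin p → ℝ => ∑ a, g a ^ 2) (Measure.pi fun _ => gaussianReal 0 w)
      (y / (2 * w)) = √((1 - y)⁻¹) ^ p := by
    simp_rw [mgf, Finset.mul_sum, Real.exp_sum]
    rw [integral_fintype_prod_eq_pow (fun x => Real.exp (y / (2 * w) * x ^ 2)),
      integral_exp_mul_sq_gaussianReal hw (by linarith), hy, Fintype.card_fin]
  rw [h, Real.exp_nat_mul]
  gcongr
  rw [Real.sqrt_le_left (by positivity), ← Real.exp_nat_mul]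
  refine (inv_one_sub_le_exp h2).trans_eq ?_
  congr 1
  push_cast
  ring

/-- Concentration of a `χ²` variable with `p` degrees of freedom. -/
theorem measure_sum_sq_sub_ge_le {w : ℝ≥0} (hw : w ≠ 0) {s : ℝ} (hs : 0 ≤ s) (hs1 : s ≤ 1) :
    (Measure.pi fun _ : Fin p => gaussianReal 0 w).real
        {g | s * (p * w) ≤ |∑ a, g a ^ 2 - p * w|} ≤ 2 * Real.exp (-(p * s ^ 2 / 8)) := by
  have hw' : (0 : ℝ) < w := by positivity
  set μ := Measure.pi fun _ : Fin p => gaussianReal 0 w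
  have hsub : {g : Fin p → ℝ | s * (p * w) ≤ |∑ a, g a ^ 2 - p * w|} ⊆
      {g | (1 + s) * (p * w) ≤ ∑ a, g a ^ 2} ∪ {g | ∑ a, g a ^ 2 ≤ (1 - s) * (p * w)} := by
    intro g hg
    rcases le_abs.1 (show s * (p * w) ≤ |∑ a, g a ^ 2 - p * w| from hg) with h | h
    · left; simp only [Set.mem_ofPred_eq]; linarith
    · right; simp only [Set.mem_ofPred_eq]; linarith
  have hup : μ.real {g | (1 + s) * (p * w) ≤ ∑ a, g a ^ 2} ≤ Real.exp (-(p * s ^ 2 / 8)) := by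
    -- Chernoff with `y = s/2`: the terms linear in `s` cancel and `-p s²/8` remains. The lower tail
    -- uses `y = -s/2`.
    refine (measure_ge_le_exp_mul_mgf (t := (s / 2) / (2 * w)) _ (by positivity)
      (integrable_exp_mul_sum_sq hw ?_)).trans ?_
    · field_simp; linarith
    · calc _ ≤ Real.exp (-((s / 2) / (2 * w)) * ((1 + s) * (p * w))) *
            Real.exp (p * ((s / 2 + (s / 2) ^ 2) / 2)) := by
            gcongr
            exact mgf_sum_sq_le hw (by linarith)
        _ = _ := by
            rw [← Real.exp_add]
            congr 1
            field_simp
            ring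
  have hlow : μ.real {g | ∑ a, g a ^ 2 ≤ (1 - s) * (p * w)} ≤ Real.exp (-(p * s ^ 2 / 8)) := by
    refine (measure_le_le_exp_mul_mgf (t := (-(s / 2)) / (2 * w)) _ ?_
      (integrable_exp_mul_sum_sq hw ?_)).trans ?_
    · rw [neg_div, neg_nonpos]; positivity
    · field_simp; linarith
    · calc _ ≤ Real.exp (-((-(s / 2)) / (2 * w)) * ((1 - s) * (p * w))) *
            Real.exp (p * ((-(s / 2) + (-(s / 2)) ^ 2) / 2)) := by
            gcongr
            exact mgf_sum_sq_le hw (by linarith)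
        _ = _ := by
            rw [← Real.exp_add]
            congr 1
            field_simp
            ring
  calc _ ≤ _ := measureReal_mono hsub
    _ ≤ _ := measureReal_union_le _ _
    _ ≤ _ := by linarith

variable {N : ℕ}

/-- A linear combination of independent centered isotropic Gaussian vectors is Gaussian. -/
theorem map_sum_smul_pi_gaussianReal (v : ℝ≥0) (c : Fin N → ℝ) :
    (Measure.pi fun _ : Fin N => Measure.pi fun _ : Fin p => gaussianReal 0 v).map
        (fun α a => ∑ i, α i a * c i) =
      Measure.pi fun _ : Fin p => gaussianReal 0 ((∑ i, Real.toNNReal (c i ^ 2)) * v) := by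
  have hmeas : Measurable fun (α : Fin N → Fin p → ℝ) (a : Fin p) => ∑ i, α i a * c i := by
    fun_prop
  have := Measure.isProbabilityMeasure_map
    (μ := Measure.pi fun _ : Fin N => Measure.pi fun _ : Fin p => gaussianReal 0 v) hmeas.aemeasurable
  refine charFun_eq_pi_iff.1 fun t => ?_
  rw [charFun_apply, integral_map (by fun_prop) (by fun_prop), integral_map hmeas.aemeasurable (by fun_prop)]
  have hexp : ∀ α : Fin N → Fin p → ℝ,
      Complex.exp ((inner ℝ (WithLp.toLp 2 fun a => ∑ i, α i a * c i) t : ℝ) * Complex.I) =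
        ∏ i, ∏ a, Complex.exp ((c i * t a : ℝ) * (α i a) * Complex.I) := by
    intro α
    simp only [← Complex.exp_sum]
    congr 1
    simp only [PiLp.inner_apply, RCLike.inner_apply, conj_trivial, Complex.ofReal_sum,
      Complex.ofReal_mul, Finset.sum_mul, Finset.mul_sum]
    rw [Finset.sum_comm]
    refine Finset.sum_congr rfl fun i _ => Finset.sum_congr rfl fun a _ => ?_
    ring
  simp_rw [hexp]
  rw [integral_fintype_prod_eq_prod (f := fun i (x : Fin p → ℝ) =>
    ∏ a, Complex.exp ((c i * t a : ℝ) * (x a) * Complex.I))]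
  have hin : ∀ i, ∫ x : Fin p → ℝ, ∏ a, Complex.exp ((c i * t a : ℝ) * (x a) * Complex.I)
      ∂(Measure.pi fun _ => gaussianReal 0 v) = ∏ a, charFun (gaussianReal 0 v) (c i * t a) := by
    intro i
    rw [integral_fintype_prod_eq_prod (f := fun a (x : ℝ) =>
      Complex.exp ((c i * t a : ℝ) * x * Complex.I))]
    simp only [charFun_apply_real]
  simp_rw [hin]
  rw [Finset.prod_comm]
  refine Finset.prod_congr rfl fun a _ => ?_
  simp_rw [charFun_gaussianReal, ← Complex.exp_sum]
  congr 1
  have : ∀ i, ((Real.toNNReal (c i ^ 2) : ℝ≥0) : ℝ) = c i ^ 2 := fun i =>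
    Real.coe_toNNReal _ (sq_nonneg _)
  push_cast
  simp only [this, Finset.sum_mul, Finset.sum_div]
  simp only [mul_zero, zero_mul, zero_sub, ← Finset.sum_neg_distrib]
  refine Finset.sum_congr rfl fun i _ => ?_
  push_cast
  ring

theorem measure_quadraticForm_sub_ge_le {v : ℝ≥0} (hv : v ≠ 0) {c : Fin N → ℝ} (hc : c ⬝ᵥ c = 4)
    {s : ℝ} (hs : 0 ≤ s) (hs1 : s ≤ 1) :
    (Measure.pi fun _ : Fin N => Measure.pi fun _ : Fin p => gaussianReal 0 v).real
        {α | 4 * s * (p * v) ≤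
          |(columns α *ᵥ c) ⬝ᵥ (columns α *ᵥ c) - 4 * (p * v)|} ≤
      2 * Real.exp (-(p * s ^ 2 / 8)) := by
  have hsum : ∑ i, Real.toNNReal (c i ^ 2) = 4 := by
    rw [← NNReal.coe_inj, NNReal.coe_sum]
    simp only [Real.coe_toNNReal _ (sq_nonneg _)]
    rw [dotProduct] at hc
    simpa [sq] using hc
  have hmap := map_sum_smul_pi_gaussianReal (p := p) v c
  rw [hsum] at hmap
  have h := measure_sum_sq_sub_ge_le (p := p) (w := 4 * v) (by simpa using hv) hs hs1
  rw [← hmap, map_measureReal_apply (by fun_prop)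
    (measurableSet_le (by fun_prop) (by fun_prop))] at h
  refine le_trans (le_of_eq ?_) h
  congr 1
  ext α
  simp only [Set.mem_ofPred_eq, Set.mem_preimage, NNReal.coe_mul, NNReal.coe_ofNat]
  have e1 : (columns α *ᵥ c) ⬝ᵥ (columns α *ᵥ c) = ∑ a, (∑ i, α i a * c i) ^ 2 := by
    simp [dotProduct, Matrix.mulVec, columns, sq]
  rw [e1, show 4 * s * (p * v : ℝ) = s * (p * (4 * v)) by ring,
    show 4 * (p * v : ℝ) = p * (4 * v) by ring]

end Gaussian

/-! ### Probability of the good event. -/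

section GoodEvent

open scoped NNReal

variable {N p : ℕ}

theorem columns_mul_coordProj_gram (α : Fin N → Fin p → ℝ) (S : Finset (Fin N)) :
    (columns α * coordProj S)ᵀ * (columns α * coordProj S) =
      coordProj S * ((columns α)ᵀ * columns α) * coordProj S := by
  rw [Matrix.transpose_mul, transpose_coordProj]
  simp only [Matrix.mul_assoc]

/-- The Gram matrix of the Gaussian vectors with index in `S` is close to the identity. -/
theorem measure_norm_gram_sub_gt_le {v : ℝ≥0} (hv : v ≠ 0) (hp : p ≠ 0) (S : Finset (Fin N))
    {s : ℝ} (hs : 0 ≤ s) (hs1 : s ≤ 1) :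
    (Measure.pi fun _ : Fin N => Measure.pi fun _ : Fin p => gaussianReal 0 v).real
        {α | 40 * s < ‖(p * v : ℝ)⁻¹ • ((columns α * coordProj S)ᵀ * (columns α * coordProj S))
          - coordProj S‖} ≤
      5 ^ S.card * (2 * Real.exp (-(p * s ^ 2 / 8))) := by
  have hv' : (0 : ℝ) < v := by positivity
  have hp' : (0 : ℝ) < p := by positivity
  obtain ⟨T, hTc, hT, hnet⟩ := exists_net_l2_opNorm_le S
  set μ := Measure.pi fun _ : Fin N => Measure.pi fun _ : Fin p => gaussianReal 0 v
  let bad : (Fin N → ℝ) → Set (Fin N → Fin p → ℝ) := fun c =>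
    {α | 4 * s * (p * v) ≤ |(columns α *ᵥ c) ⬝ᵥ (columns α *ᵥ c) - 4 * (p * v)|}
  have hsub : {α : Fin N → Fin p → ℝ | 40 * s < ‖(p * v : ℝ)⁻¹ •
      ((columns α * coordProj S)ᵀ * (columns α * coordProj S)) - coordProj S‖} ⊆
      ⋃ c ∈ T, bad c := by
    intro α hα
    by_contra hnot
    simp only [Set.mem_iUnion, not_exists] at hnot
    refine absurd (hnet _ ?_ ?_ s hs ?_) (not_le.2 hα)
    · rw [Matrix.transpose_sub, Matrix.transpose_smul, Matrix.transpose_mul,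
        Matrix.transpose_transpose, transpose_coordProj]
    · rw [columns_mul_coordProj_gram, Matrix.mul_sub, Matrix.sub_mul, coordProj_mul_self,
        coordProj_mul_self, Matrix.mul_smul, Matrix.smul_mul]
      congr 2
      rw [Matrix.mul_assoc, Matrix.mul_assoc (coordProj S * _), coordProj_mul_self,
        ← Matrix.mul_assoc, ← Matrix.mul_assoc, coordProj_mul_self]
    · intro c hc
      have h1 : ¬ 4 * s * (p * v) ≤ |(columns α *ᵥ c) ⬝ᵥ (columns α *ᵥ c) - 4 * (p * v)| :=
        hnot c hc
      have hJc : coordProj S *ᵥ c = c := by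
        ext i
        by_cases hi : i ∈ S
        · simp [coordProj, Matrix.mulVec_diagonal, hi]
        · simp [coordProj, Matrix.mulVec_diagonal, hi, (hT c hc).2 i hi]
      have h2 : c ⬝ᵥ ((p * v : ℝ)⁻¹ • ((columns α * coordProj S)ᵀ * (columns α * coordProj S))
          - coordProj S) *ᵥ c =
          (p * v : ℝ)⁻¹ * ((columns α *ᵥ c) ⬝ᵥ (columns α *ᵥ c) - 4 * (p * v)) := by
        rw [Matrix.sub_mulVec, Matrix.smul_mulVec, ← Matrix.mulVec_mulVec, ← Matrix.mulVec_mulVec,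
          hJc, dotProduct_sub, (hT c hc).1, dotProduct_smul, Matrix.dotProduct_mulVec,
          ← Matrix.mulVec_transpose, Matrix.transpose_transpose, ← Matrix.mulVec_mulVec, hJc,
          smul_eq_mul]
        field_simp
      rw [h2, abs_mul, abs_of_pos (by positivity), inv_mul_le_iff₀ (by positivity)]
      linarith
  calc _ ≤ _ := measureReal_mono hsub (measure_ne_top _ _)
    _ ≤ ∑ c ∈ T, μ.real (bad c) := measureReal_biUnion_finset_le _ _
    _ ≤ ∑ c ∈ T, 2 * Real.exp (-(p * s ^ 2 / 8)) :=
        Finset.sum_le_sum fun c hc => measure_quadraticForm_sub_ge_le hv (hT c hc).1 hs hs1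
    _ = T.card * (2 * Real.exp (-(p * s ^ 2 / 8))) := by rw [Finset.sum_const, nsmul_eq_mul]
    _ ≤ _ := by
        gcongr
        exact_mod_cast hTc

theorem five_pow_le_exp (n : ℕ) : (5 : ℝ) ^ n ≤ Real.exp (2 * n) := by
  have h := Real.quadratic_le_exp_of_nonneg (show (0 : ℝ) ≤ 2 by norm_num)
  rw [mul_comm, Real.exp_nat_mul]
  gcongr
  linarith

/-- The operator norm of the noise matrix. -/
theorem measure_norm_noise_gt_le {d : ℕ} (hd : d ≠ 0) (hN : 20000 * (N : ℝ) ≤ d) {σ : ℝ}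
    (hσ : 0 ≤ σ) :
    (Measure.pi fun _ : Fin N => Measure.pi fun _ : Fin d =>
        gaussianReal 0 (Real.toNNReal (σ ^ 2 / d))).real {δ | 2 * σ < ‖columns δ‖} ≤
      2 * Real.exp (-(1 / 6400) * d) := by
  have hd' : (0 : ℝ) < d := by positivity
  rcases hσ.eq_or_lt with rfl | hσ
  -- For `σ = 0` the noise is a point mass at `0`; the general argument divides by the variance.
  · have h0 : (Measure.pi fun _ : Fin N => Measure.pi fun _ : Fin d =>
        gaussianReal 0 (Real.toNNReal ((0 : ℝ) ^ 2 / d))).real {δ | 2 * (0 : ℝ) < ‖columns δ‖} = 0 := by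
      rw [measureReal_eq_zero_iff]
      refine measure_mono_null (t := {0}ᶜ) (fun δ hδ h => ?_) ?_
      · rw [Set.mem_singleton_iff.1 h] at hδ
        have : columns (0 : Fin N → Fin d → ℝ) = 0 := rfl
        simp [this] at hδ
      · rw [prob_compl_eq_zero_iff (measurableSet_singleton _), Measure.pi_singleton]
        simp [Measure.pi_singleton, gaussianReal_zero_var]
    rw [h0]
    positivity
  · have hv : (Real.toNNReal (σ ^ 2 / d)) ≠ 0 := by
      simp only [ne_eq, Real.toNNReal_eq_zero, not_le]; positivity
    have hdv : (d : ℝ) * (Real.toNNReal (σ ^ 2 / d)) = σ ^ 2 := by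
      rw [Real.coe_toNNReal _ (by positivity)]; field_simp
    -- With `s = 1/20` the normalized Gram matrix is within `2` of `I`, so its norm is at most `3 <
    -- 4`. The tail `exp (-d/3200)` beats the net size `exp (2N) ≤ exp (d/10000)`.
    have h := measure_norm_gram_sub_gt_le (N := N) hv hd Finset.univ (s := 1 / 20) (by norm_num)
      (by norm_num)
    have hJ : coordProj (Finset.univ : Finset (Fin N)) = 1 := by simp [coordProj]
    rw [hdv, hJ] at h
    simp only [Matrix.mul_one] at h
    have hsub : {δ : Fin N → Fin d → ℝ | 2 * σ < ‖columns δ‖} ⊆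
        {δ | 40 * (1 / 20) < ‖(σ ^ 2)⁻¹ • ((columns δ)ᵀ * columns δ) - 1‖} := by
      intro δ hδ
      have hδ' : 2 * σ < ‖columns δ‖ := hδ
      have h1 : ‖(σ ^ 2)⁻¹ • ((columns δ)ᵀ * columns δ)‖ ≤
          ‖(σ ^ 2)⁻¹ • ((columns δ)ᵀ * columns δ) - 1‖ + ‖(1 : Matrix (Fin N) (Fin N) ℝ)‖ :=
        norm_le_norm_sub_add _ _
      have h2 : ‖(1 : Matrix (Fin N) (Fin N) ℝ)‖ ≤ 1 := hJ ▸ norm_coordProj_le_one _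
      rw [norm_smul, Real.norm_of_nonneg (by positivity), l2_opNorm_transpose_mul_self] at h1
      have h3 : 4 < (σ ^ 2)⁻¹ * (‖columns δ‖ * ‖columns δ‖) := by
        rw [lt_inv_mul_iff₀ (by positivity)]
        nlinarith
      simp only [Set.mem_ofPred_eq]
      linarith
    refine (measureReal_mono hsub).trans (h.trans ?_)
    rw [Finset.card_univ, Fintype.card_fin]
    calc (5 : ℝ) ^ N * (2 * Real.exp (-(d * (1 / 20) ^ 2 / 8)))
        ≤ Real.exp (2 * N) * (2 * Real.exp (-(d * (1 / 20) ^ 2 / 8))) := by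
          gcongr
          exact five_pow_le_exp N
      _ = 2 * Real.exp (2 * N + -(d * (1 / 20) ^ 2 / 8)) := by rw [Real.exp_add]; ring
      _ ≤ _ := by
          gcongr
          linarith

/-- The indices of the tokens from the `k`-th subspace. -/
def labelClass {K : ℕ} (s : Fin N → Fin K) (k : Fin K) : Finset (Fin N) :=
  Finset.univ.filter fun i => s i = k

/-- The summand factors over tokens, and each token contributes `5 + (K - 1)`. -/
theorem sum_five_pow_card_labelClass {K : ℕ} (k : Fin K) :
    ∑ s : Fin N → Fin K, (5 : ℝ) ^ (labelClass s k).card = (K + 4) ^ N := by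
  have h1 : ∀ s : Fin N → Fin K, (5 : ℝ) ^ (labelClass s k).card =
      ∏ i, if s i = k then (5 : ℝ) else 1 := by
    intro s
    rw [Finset.prod_ite, Finset.prod_const, Finset.prod_const_one, mul_one, labelClass]
  simp_rw [h1]
  have h2 := Finset.prod_univ_sum (fun _ : Fin N => (Finset.univ : Finset (Fin K)))
    (fun _ j => if j = k then (5 : ℝ) else 1)
  rw [Fintype.piFinset_univ] at h2
  rw [← h2, Finset.prod_const, Finset.card_univ, Fintype.card_fin]
  congr 1
  have h3 : ∀ j : Fin K, (if j = k then (5 : ℝ) else 1) = 1 + if j = k then 4 else 0 := by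
    intro j
    split_ifs <;> norm_num
  simp_rw [h3, Finset.sum_add_distrib]
  simp

theorem uniformOn_pi_singleton {K : ℕ} [NeZero K] (s : Fin N → Fin K) :
    (Measure.pi fun _ : Fin N => uniformOn (Set.univ : Set (Fin K))).real {s} =
      ((K : ℝ)⁻¹) ^ N := by
  rw [measureReal_def, Measure.pi_singleton, ENNReal.toReal_prod]
  simp [uniformOn_univ]

/-- The event that the noise matrix is bounded and that the coefficient vectors of each subspace
are nearly orthonormal. -/
def goodEvent (d N p K : ℕ) (σ t : ℝ) : Set (Outcome d N p K) :=
  {ω | ‖columns ω.2.2‖ ≤ 2 * σ ∧ ∀ k, ‖(columns ω.2.1 * coordProj (labelClass ω.1 k))ᵀ *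
    (columns ω.2.1 * coordProj (labelClass ω.1 k)) - coordProj (labelClass ω.1 k)‖ ≤ t}

instance {d K : ℕ} [NeZero K] {σ : ℝ} : IsProbabilityMeasure (tokenLaw d N p K σ) := by
  unfold tokenLaw
  infer_instance

theorem tokenLaw_compl_goodEvent_le {d K : ℕ} [NeZero K] (hd : d ≠ 0) (hp : p ≠ 0)
    (hN : 20000 * (N : ℝ) ≤ d) {σ : ℝ} (hσ : 0 ≤ σ) {s : ℝ} (hs : 0 ≤ s) (hs1 : s ≤ 1)
    (hps : p * s ^ 2 = 64 * (N / K : ℝ)) :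
    (tokenLaw d N p K σ).real (goodEvent d N p K σ (40 * s))ᶜ ≤
      2 * Real.exp (-(1 / 6400) * d) + K * (2 * Real.exp (-4 * (N / K : ℝ))) := by
  have hK : (0 : ℝ) < K := by exact_mod_cast Nat.pos_of_ne_zero (NeZero.ne K)
  set v := Real.toNNReal (1 / p) with hvdef
  have hp' : (0 : ℝ) < p := by positivity
  have hv : v ≠ 0 := by
    simp only [hvdef, ne_eq, Real.toNNReal_eq_zero, not_le]; positivity
  have hpv : (p : ℝ) * v = 1 := by
    rw [hvdef, Real.coe_toNNReal _ (by positivity)]; field_simp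
  let badα : (Fin N → Fin K) → Fin K → Set (Fin N → Fin p → ℝ) := fun s₀ k =>
    {α | 40 * s < ‖(columns α * coordProj (labelClass s₀ k))ᵀ *
      (columns α * coordProj (labelClass s₀ k)) - coordProj (labelClass s₀ k)‖}
  let badδ : Set (Fin N → Fin d → ℝ) := {δ | 2 * σ < ‖columns δ‖}
  -- Covering by rectangles lets the product measure factor without any measurability of the bad
  -- sets.
  have hsub : (goodEvent d N p K σ (40 * s))ᶜ ⊆
      (Set.univ ×ˢ (Set.univ ×ˢ badδ)) ∪
        ⋃ k : Fin K, ⋃ s₀ : Fin N → Fin K, {s₀} ×ˢ (badα s₀ k ×ˢ Set.univ) := by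
    intro ω hω
    by_cases h : ‖columns ω.2.2‖ ≤ 2 * σ
    · right
      have h2 : ¬ ∀ k, ‖(columns ω.2.1 * coordProj (labelClass ω.1 k))ᵀ *
          (columns ω.2.1 * coordProj (labelClass ω.1 k)) - coordProj (labelClass ω.1 k)‖ ≤ 40 * s :=
        fun h' => hω ⟨h, h'⟩
      push Not at h2
      obtain ⟨k, hk⟩ := h2
      simp only [Set.mem_iUnion]
      exact ⟨k, ω.1, rfl, hk, trivial⟩
    · left
      exact ⟨trivial, trivial, not_le.1 h⟩
  have hα : ∀ s₀ k, (Measure.pi fun _ : Fin N => Measure.pi fun _ : Fin p =>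
      gaussianReal 0 v).real (badα s₀ k) ≤
        5 ^ (labelClass s₀ k).card * (2 * Real.exp (-(p * s ^ 2 / 8))) := by
    intro s₀ k
    have := measure_norm_gram_sub_gt_le hv hp (labelClass s₀ k) hs hs1
    rw [hpv] at this
    simpa only [inv_one, one_smul] using this
  have hk : ∀ k : Fin K, ∑ s₀ : Fin N → Fin K,
      (tokenLaw d N p K σ).real ({s₀} ×ˢ (badα s₀ k ×ˢ Set.univ)) ≤
        2 * Real.exp (-4 * (N / K : ℝ)) := by
    intro k
    calc _ ≤ ∑ s₀ : Fin N → Fin K, ((K : ℝ)⁻¹) ^ N *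
          (5 ^ (labelClass s₀ k).card * (2 * Real.exp (-(p * s ^ 2 / 8)))) := by
          refine Finset.sum_le_sum fun s₀ _ => ?_
          rw [tokenLaw, measureReal_prod_prod, measureReal_prod_prod, uniformOn_pi_singleton,
            probReal_univ, mul_one]
          gcongr
          exact hα s₀ k
      _ = ((K : ℝ)⁻¹ * (K + 4)) ^ N * (2 * Real.exp (-(p * s ^ 2 / 8))) := by
          rw [← Finset.mul_sum, ← Finset.sum_mul, sum_five_pow_card_labelClass, mul_pow]
          ring
      _ ≤ Real.exp (4 / K) ^ N * (2 * Real.exp (-(p * s ^ 2 / 8))) := by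
          gcongr
          refine le_trans (le_of_eq ?_) (Real.add_one_le_exp _)
          field_simp
          ring
      _ = _ := by
          rw [← Real.exp_nat_mul, hps, mul_left_comm, ← Real.exp_add]
          congr 2
          ring
  have hδ : (tokenLaw d N p K σ).real (Set.univ ×ˢ (Set.univ ×ˢ badδ)) ≤
      2 * Real.exp (-(1 / 6400) * d) := by
    rw [tokenLaw, measureReal_prod_prod, measureReal_prod_prod, probReal_univ, probReal_univ,
      one_mul, one_mul]
    exact measure_norm_noise_gt_le hd hN hσ
  calc _ ≤ _ := measureReal_mono hsub
    _ ≤ _ := measureReal_union_le _ _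
    _ ≤ 2 * Real.exp (-(1 / 6400) * d) + ∑ k : Fin K, 2 * Real.exp (-4 * (N / K : ℝ)) := by
        refine add_le_add hδ ((measureReal_iUnion_fintype_le _).trans
          (Finset.sum_le_sum fun k _ => (measureReal_iUnion_fintype_le _).trans (hk k)))
    _ = _ := by simp

end GoodEvent

/-! ### Reduction of the gradient step to single blocks. -/

section Decomposition

variable {d N p K : ℕ}

theorem norm_le_one_of_transpose_mul_self_eq_one {m n : Type*} [Fintype m] [Fintype n]
    [DecidableEq m] [DecidableEq n] {V : Matrix m n ℝ} (hV : Vᵀ * V = 1) : ‖V‖ ≤ 1 := by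
  have h1 := l2_opNorm_transpose_mul_self V
  have h2 : ‖(1 : Matrix n n ℝ)‖ ≤ 1 := by
    have := norm_coordProj_le_one (Finset.univ : Finset n)
    rwa [show coordProj (Finset.univ : Finset n) = 1 by simp [coordProj]] at this
  rw [hV] at h1
  nlinarith [norm_nonneg V]

theorem mul_coordProj_labelClass_apply {m : Type*} (M : Matrix m (Fin N) ℝ) (s : Fin N → Fin K)
    (k : Fin K) (a : m) (i : Fin N) :
    (M * coordProj (labelClass s k)) a i = if s i = k then M a i else 0 := by
  simp [coordProj, Matrix.mul_diagonal, labelClass]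

theorem cleanTokens_eq_sum (U : Fin K → Matrix (Fin d) (Fin p) ℝ) (s : Fin N → Fin K)
    (α : Fin N → Fin p → ℝ) :
    cleanTokens U s α = ∑ k, U k * (columns α * coordProj (labelClass s k)) := by
  ext a i
  rw [Matrix.sum_apply]
  simp_rw [← Matrix.mul_assoc, mul_coordProj_labelClass_apply]
  rw [Finset.sum_ite_eq Finset.univ (s i), if_pos (Finset.mem_univ _)]
  rfl

theorem transpose_mul_cleanTokens {U : Fin K → Matrix (Fin d) (Fin p) ℝ}
    (h1 : ∀ k, (U k)ᵀ * U k = 1) (h0 : ∀ k k', k ≠ k' → (U k)ᵀ * U k' = 0) (s : Fin N → Fin K)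
    (α : Fin N → Fin p → ℝ) (k : Fin K) :
    (U k)ᵀ * cleanTokens U s α = columns α * coordProj (labelClass s k) := by
  rw [cleanTokens_eq_sum, Matrix.mul_sum, Finset.sum_eq_single k, ← Matrix.mul_assoc, h1,
    Matrix.one_mul]
  · intro k' _ hk
    rw [← Matrix.mul_assoc, h0 k k' hk.symm, Matrix.zero_mul]
  · simp

theorem mul_transpose_permMatrix (M : Matrix (Fin p) (Fin N) ℝ) (π : Equiv.Perm (Fin N)) :
    M * (π.permMatrix ℝ)ᵀ = M.submatrix id π := by
  ext a j
  simp [Matrix.mul_apply, PEquiv.toMatrix_apply, Equiv.toPEquiv_apply, Equiv.symm_apply_eq]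

theorem mul_permMatrix_apply (M : Matrix (Fin p) (Fin N) ℝ) (π : Equiv.Perm (Fin N)) (a : Fin p)
    (i : Fin N) : (M * π.permMatrix ℝ) a i = M a (π.symm i) := by
  simp [Matrix.mul_apply, PEquiv.toMatrix_apply, Equiv.toPEquiv_apply, ← Equiv.eq_symm_apply]

/-- Resolvents see a matrix only through `X Xᵀ`, which is unchanged by permuting columns or padding
with zeros. Blocks of varying width can thus be replaced by masked matrices of fixed size. -/
theorem block_mul_transpose (π : Equiv.Perm (Fin N)) (s : Fin N → Fin K)
    (M : Matrix (Fin p) (Fin N) ℝ) (k : Fin K) :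
    block (s ∘ π) (M.submatrix id π) k * (block (s ∘ π) (M.submatrix id π) k)ᵀ =
      (M * coordProj (labelClass s k)) * (M * coordProj (labelClass s k))ᵀ := by
  ext a b
  rw [Matrix.mul_apply, Matrix.mul_apply]
  simp only [Matrix.transpose_apply, mul_coordProj_labelClass_apply, block,
    Matrix.submatrix_apply, id]
  rw [← Equiv.sum_comp π, ← Finset.sum_subtype (Finset.univ.filter fun j => s (π j) = k) (by simp)
    (fun j => M a (π j) * M b (π j)), Finset.sum_filter]
  refine Finset.sum_congr rfl fun j _ => ?_
  split_ifs <;> simp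

theorem blockProjection_perm (U : Fin K → Matrix (Fin d) (Fin p) ℝ) {β : ℝ} (hβ : 0 < β)
    (π : Equiv.Perm (Fin N)) (s : Fin N → Fin K) (M : Matrix (Fin p) (Fin N) ℝ) (k : Fin K) :
    blockProjection U β (s ∘ π) (M.submatrix id π) k =
      ∑ k' ∈ Finset.univ.erase k,
        U k' * resolvent β (M * coordProj (labelClass s k')) * (U k')ᵀ := by
  refine Finset.sum_congr rfl fun k' _ => ?_
  rw [one_sub_mul_inv_mul_transpose hβ, resolvent, block_mul_transpose, resolvent]

/-- A token of class `i` is hit by all `k ≠ i`, which the mask `1 - coordProj` encodes. The right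
side is free of `π`, so one event serves all permutations at once. -/
theorem projection_perm (U : Fin K → Matrix (Fin d) (Fin p) ℝ) {β : ℝ} (hβ : 0 < β)
    (π : Equiv.Perm (Fin N)) (s : Fin N → Fin K) (A : Matrix (Fin p) (Fin N) ℝ)
    (D : Matrix (Fin d) (Fin N) ℝ) :
    projection U β (s ∘ π) (A * (π.permMatrix ℝ)ᵀ) (β • (D * (π.permMatrix ℝ)ᵀ)) *
        π.permMatrix ℝ =
      ∑ k, U k * (β • (resolvent β (A * coordProj (labelClass s k)) *
        ((U k)ᵀ * D * (1 - coordProj (labelClass s k))))) := by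
  rw [mul_transpose_permMatrix, mul_transpose_permMatrix]
  ext a i
  have hterm : ∀ k, (U k * (β • (resolvent β (A * coordProj (labelClass s k)) *
      ((U k)ᵀ * D * (1 - coordProj (labelClass s k))))) : Matrix (Fin d) (Fin N) ℝ) a i =
      if s i = k then 0
      else β * (U k * resolvent β (A * coordProj (labelClass s k)) * (U k)ᵀ * D) a i := by
    intro k
    have h1 : U k * (β • (resolvent β (A * coordProj (labelClass s k)) *
        ((U k)ᵀ * D * (1 - coordProj (labelClass s k))))) =
        β • (U k * resolvent β (A * coordProj (labelClass s k)) * (U k)ᵀ * D -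
          U k * resolvent β (A * coordProj (labelClass s k)) * (U k)ᵀ * D *
            coordProj (labelClass s k)) := by
      simp only [Matrix.mul_smul, Matrix.mul_sub, Matrix.mul_one, Matrix.mul_assoc]
    rw [h1, Matrix.smul_apply, Matrix.sub_apply, mul_coordProj_labelClass_apply, smul_eq_mul]
    split_ifs <;> simp
  rw [mul_permMatrix_apply, Matrix.sum_apply]
  simp_rw [hterm]
  rw [← Finset.sum_erase (a := s i) Finset.univ (by simp)]
  change (blockProjection U β (s ∘ π) (A.submatrix id π) ((s ∘ π) (π.symm i)) *ᵥ
    (β • D.submatrix id π).col (π.symm i)) a = _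
  rw [blockProjection_perm U hβ, Function.comp_apply, Equiv.apply_symm_apply, Matrix.sum_mulVec,
    Finset.sum_apply]
  refine Finset.sum_congr rfl fun k hk => ?_
  rw [if_neg (Finset.ne_of_mem_erase hk).symm]
  have h2 : (β • D.submatrix id π).col (π.symm i) = β • D.col i := by
    ext b
    simp [Matrix.col]
  rw [h2, Matrix.mulVec_smul, Pi.smul_apply, smul_eq_mul]
  rfl

/-- The difference between the gradient step and its nominal value, block by block. -/
theorem gradientStep_sub_nominalStep {U : Fin K → Matrix (Fin d) (Fin p) ℝ}
    (h1 : ∀ k, (U k)ᵀ * U k = 1) (h0 : ∀ k k', k ≠ k' → (U k)ᵀ * U k' = 0) {β : ℝ} (hβ : 0 < β)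
    (η : ℝ) (π : Equiv.Perm (Fin N)) (s : Fin N → Fin K) (α : Fin N → Fin p → ℝ)
    (δ : Fin N → Fin d → ℝ) :
    gradientStep U β η (cleanTokens U s α + columns δ) - nominalStep U β η π s α δ =
      -(η • ∑ k, U k * (
        β • (resolvent β (columns α * coordProj (labelClass s k) + (U k)ᵀ * columns δ) *
          (columns α * coordProj (labelClass s k) + (U k)ᵀ * columns δ)) -
        (β • (resolvent β (columns α * coordProj (labelClass s k)) *
          ((U k)ᵀ * columns δ * (1 - coordProj (labelClass s k)))) +
        (β / (1 + β)) • (columns α * coordProj (labelClass s k))))) := by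
  rw [gradientStep, nominalStep, matrixGradient_codingRate U hβ.le, projection_perm U hβ]
  simp only [Matrix.mul_add, transpose_mul_cleanTokens h1 h0, Matrix.mul_sub,
    Finset.sum_sub_distrib, Finset.sum_add_distrib]
  have hX : ∑ k, U k * ((β / (1 + β)) • (columns α * coordProj (labelClass s k))) =
      (β / (1 + β)) • cleanTokens U s α := by
    rw [cleanTokens_eq_sum, Finset.smul_sum]
    simp only [Matrix.mul_smul]
  have hc : (1 + β⁻¹ - η) / (1 + β⁻¹) = 1 - η * (β / (1 + β)) := by
    field_simp
    ring
  rw [hX, hc, sub_smul, one_smul, mul_smul]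
  simp only [smul_sub, smul_add]
  abel

theorem norm_gradientStep_sub_nominalStep_le {U : Fin K → Matrix (Fin d) (Fin p) ℝ}
    (h1 : ∀ k, (U k)ᵀ * U k = 1) (h0 : ∀ k k', k ≠ k' → (U k)ᵀ * U k' = 0) {β σ η t : ℝ}
    (hβ : 0 < β) (hσ : 0 ≤ σ) (hσ1 : σ ≤ 1) (hβσ : 100 * β * σ ≤ 1 / 2) (hη : 0 ≤ η)
    (ht : t ≤ 1 / 4) {ω : Outcome d N p K} (hω : ω ∈ goodEvent d N p K σ t)
    (π : Equiv.Perm (Fin N)) :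
    ‖gradientStep U β η (cleanTokens U ω.1 ω.2.1 + columns ω.2.2)
        - nominalStep U β η π ω.1 ω.2.1 ω.2.2‖ ≤
      η * (K * (128 * (σ ^ 2 * β ^ 2 + σ + β * σ ^ 2) + 8 * t)) := by
  rw [gradientStep_sub_nominalStep h1 h0 hβ, norm_neg, norm_smul, Real.norm_of_nonneg hη]
  gcongr
  refine (norm_sum_le _ _).trans ?_
  refine (Finset.sum_le_card_nsmul _ _ (128 * (σ ^ 2 * β ^ 2 + σ + β * σ ^ 2) + 8 * t)
    fun k _ => ?_).trans_eq (by rw [Finset.card_univ, Fintype.card_fin, nsmul_eq_mul])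
  have hU := norm_le_one_of_transpose_mul_self_eq_one (h1 k)
  have hD : ‖(U k)ᵀ * columns ω.2.2‖ ≤ 2 * σ := by
    refine (Matrix.l2_opNorm_mul _ _).trans ?_
    rw [l2_opNorm_transpose]
    nlinarith [hω.1, norm_nonneg (columns ω.2.2)]
  have hE := norm_resolvent_perturbation_le hβ (transpose_coordProj (labelClass ω.1 k))
    (coordProj_mul_self _) (norm_coordProj_le_one _)
    (show columns ω.2.1 * coordProj (labelClass ω.1 k) * coordProj (labelClass ω.1 k) = _ by
      rw [Matrix.mul_assoc, coordProj_mul_self]) (hω.2 k) ht hσ hσ1 hβσ hD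
  exact (Matrix.l2_opNorm_mul _ _).trans ((mul_le_mul hU hE (norm_nonneg _) zero_le_one).trans_eq
    (one_mul _))

end Decomposition

end TokenCompression

/-! ### Choice of constants and conclusion. -/

theorem mainTheorem1 :
    ∃ c₁ c₂ c₃ C₁ C₂ C₃ C₄ C₅ : ℝ,
      0 < c₁ ∧ 0 < c₂ ∧ 0 < c₃ ∧ 0 < C₁ ∧ 0 < C₂ ∧ 0 < C₃ ∧ 0 < C₄ ∧ 0 < C₅ ∧
      ∀ (d N p K : ℕ) (U : Fin K → Matrix (Fin d) (Fin p) ℝ) (ε σ η : ℝ),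
        ParameterConfig c₁ c₂ c₃ N ε U →
        0 ≤ σ → σ ≤ 1 → C₁ * quantBeta N p ε * σ ≤ 1 / 2 → 0 < η →
        1 - K * C₂ * (Real.exp (-C₃ * d) + Real.exp (-C₄ * (N / K)) + ((N : ℝ) ^ 2)⁻¹) ≤
          (tokenLaw d N p K σ).real
            {ω | ∀ π : Equiv.Perm (Fin N), Monotone (ω.1 ∘ π) →
              ‖gradientStep U (quantBeta N p ε) η (cleanTokens U ω.1 ω.2.1 + columns ω.2.2)
                  - nominalStep U (quantBeta N p ε) η π ω.1 ω.2.1 ω.2.2‖ ≤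
                C₅ * K * η * (σ ^ 2 * quantBeta N p ε ^ 2 + σ * (1 + √(N / d))
                  + √K * quantBeta N p ε * σ ^ 2 * (1 + √(N / d)) + √(N / d))} := by
  -- `c₂ = 600` makes `√(N/d) ≤ 1/1280`, hence `t = 320 √(N/d) ≤ 1/4`; `c₃ = 100` gives `20000 N ≤
  -- d` for the noise bound; `C₅ = 2560` is `8 t / √(N/d)`.
  refine ⟨1, 600, 100, 100, 2, 1 / 6400, 4, 2560, by norm_num, by norm_num, by norm_num,
    by norm_num, by norm_num, by norm_num, by norm_num, by norm_num, ?_⟩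
  intro d N p K U ε σ η hP hσ hσ1 hβσ hη
  have hK2 := hP.two_le_K
  have hp2 : 2 ≤ p := hK2.trans hP.K_le_p
  have hN2 : 2 ≤ N := hp2.trans hP.p_le_N
  have hd2 : 2 ≤ d := hN2.trans hP.N_le_d
  have : NeZero K := ⟨by omega⟩
  have hK : (2 : ℝ) ≤ K := by exact_mod_cast hK2
  have hp : (2 : ℝ) ≤ p := by exact_mod_cast hp2
  have hN : (2 : ℝ) ≤ N := by exact_mod_cast hN2
  have hd : (2 : ℝ) ≤ d := by exact_mod_cast hd2
  have hKp : (K : ℝ) * p = d := by exact_mod_cast hP.K_mul_p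
  have hε := hP.eps_pos
  have hasp := hP.aspect_ratio
  have hasp' := hP.aspect_ratio'
  set β := quantBeta N p ε with hβdef
  have hβ : 0 < β := by
    rw [hβdef, quantBeta]
    positivity
  set r := √(N / d : ℝ) with hr
  have hr0 : 0 ≤ r := Real.sqrt_nonneg _
  have hr2 : r ^ 2 = N / d := Real.sq_sqrt (by positivity)
  have hr1 : r ≤ 1 / 1280 := by
    rw [hr, Real.sqrt_le_left (by norm_num), div_le_iff₀ (by positivity)]
    linarith
  -- Since `d = K p`, the choice `s = 8 √(N/d)` gives `p s² / 8 = 8 N/K`, twice the exponent `4 N/K`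
  -- spent on the averaged net size.
  have hgood := tokenLaw_compl_goodEvent_le (N := N) (p := p) (K := K) (d := d) (by omega)
    (by omega) (by linarith) hσ (s := 8 * r) (by positivity) (by linarith) (by
      rw [mul_pow, hr2, ← hKp]
      field_simp
      norm_num)
  have hsub : goodEvent d N p K σ (40 * (8 * r)) ⊆
      {ω | ∀ π : Equiv.Perm (Fin N), Monotone (ω.1 ∘ π) →
        ‖gradientStep U β η (cleanTokens U ω.1 ω.2.1 + columns ω.2.2)
          - nominalStep U β η π ω.1 ω.2.1 ω.2.2‖ ≤
            2560 * K * η * (σ ^ 2 * β ^ 2 + σ * (1 + r) + √K * β * σ ^ 2 * (1 + r) + r)} := by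
    intro ω hω π _
    refine (norm_gradientStep_sub_nominalStep_le hP.orthonormal hP.orthogonal hβ hσ hσ1 hβσ hη.le
      (by linarith) hω π).trans ?_
    have hsK : 1 ≤ √(K : ℝ) := Real.one_le_sqrt.2 (by linarith)
    have h1 : σ ≤ σ * (1 + r) := by nlinarith
    have h2 : β * σ ^ 2 ≤ √K * β * σ ^ 2 * (1 + r) := by
      have h3 : 1 ≤ √(K : ℝ) * (1 + r) := by nlinarith
      have h4 : 0 ≤ β * σ ^ 2 := by positivity
      nlinarith
    have h5 : 128 * (σ ^ 2 * β ^ 2 + σ + β * σ ^ 2) + 8 * (40 * (8 * r)) ≤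
        2560 * (σ ^ 2 * β ^ 2 + σ * (1 + r) + √K * β * σ ^ 2 * (1 + r) + r) := by
      have h6 : 0 ≤ σ ^ 2 * β ^ 2 := by positivity
      have h7 : 0 ≤ β * σ ^ 2 := by positivity
      linarith
    calc _ ≤ η * (K * (2560 * (σ ^ 2 * β ^ 2 + σ * (1 + r) + √K * β * σ ^ 2 * (1 + r) + r))) := by
          gcongr
      _ = _ := by ring
  -- Subadditivity alone yields this direction, so the good event need not be shown measurable.
  have h1 : 1 ≤ (tokenLaw d N p K σ).real (goodEvent d N p K σ (40 * (8 * r))) +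
      (tokenLaw d N p K σ).real (goodEvent d N p K σ (40 * (8 * r)))ᶜ := by
    have := measureReal_union_le (μ := tokenLaw d N p K σ) (goodEvent d N p K σ (40 * (8 * r)))
      (goodEvent d N p K σ (40 * (8 * r)))ᶜ
    rwa [Set.union_compl_self, probReal_univ] at this
  refine le_trans ?_ (measureReal_mono hsub (measure_ne_top _ _))
  have h2 : Real.exp (-(1 / 6400) * d) ≤ K * Real.exp (-(1 / 6400) * d) := by
    nlinarith [Real.exp_pos (-(1 / 6400) * d)]
  have h3 : 0 ≤ K * ((N : ℝ) ^ 2)⁻¹ := by positivity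
  linarith
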